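/- Let $d\ge 1$, let $p$ be a probability measure on a measurable space $\mathcal X$, and let $(\Omega,\mathcal F,P)$ be a probability space. Let $W$ and $B$ be Gaussian independently scattered random measures (centred, with variance of $W(A)$, resp. $B(A)$, equal to the control measure of $A$) on $\mathcal X\times\mathbb R^d$ with control measure $p(dx)\,ds$, and on $\mathbb R^d$ with control measure $ds$, respectively. Let $\sigma=(\sigma(s))_{s\in\mathbb R^d}$ be a strictly stationary random field with $\mathbb E\,\sigma(0)^2<\infty$, independent of $W$ and independent of $B$. Take the first coordinate of $\mathbb R^d$ as time, and let $(\mathcal F_r)_{r\in\mathbb R}$ be a filtration such that, for every $r$, the noise $W$ restricted to times $\le r$ is $\mathcal F_r$-measurable and $W$ restricted to times $>r$ is independent of $\mathcal F_r$; let $(\mathcal G_r)_{r\in\mathbb R}$ be a filtration with the same property for $B$. Assume that $\sigma$ is predictable for both filtrations. Stochastic integrals of predictable integrands are understood in the sense of Walsh, i.e. as $L^2(P)$-limits of integrals of simple predictable integrands. Let $g:\mathcal X\times\mathbb R^d\to\mathbb R$ be measurable with $\int_{\mathcal X\times\mathbb R^d} g^2(x,s)\,p(dx)\,ds<\infty$,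 and let $$X(t)=\int_{\mathcal X\times\mathbb R^d} g(x,t-s)\,\sigma(s)\,W(dx,ds),\qquad t\in\mathbb R^d .$$ Write $\widehat h(u)=(2\pi)^{-d/2}\int_{\mathbb R^d}e^{-iu^\top s}h(s)\,ds$ for the unitary Fourier transform on $L^2(\mathbb R^d)$, let $\widehat g(x,u)$ be a jointly measurable version of the Fourier transform of $g(x,\cdot)$ at $u$, and put $$\gamma(u)=\int_{\mathcal X}|\widehat g(x,u)|^2\,p(dx),\qquad u\in\mathbb R^d .$$ Let $f=\kappa\,\widehat{\gamma^{1/2}}$ with a real constant $\kappa\neq0$, and let $$Z(t)=\int_{\mathbb R^d} f(t-s)\,\sigma(s)\,B(ds),\qquad t\in\mathbb R^d .$$ Then $\gamma^{1/2}\in L^2(\mathbb R^d)$, its Fourier transform is real valued almost everywhere, and $X(t)$ and $Z(t)$ are well-defined square integrable random variables for all $t$. Moreover: 1. $X$ and $Z$ have identical correlation structure: $\operatorname{Cor}(Z(t),Z(t'))=\operatorname{Cor}(X(t),X(t'))$ for all $t,t'\in\mathbb R^d$ (with the correlation read as $0$ when a variance vanishes); more precisely, $\operatorname{Cov}(Z(t),Z(t'))=\kappa^2\operatorname{Cov}(X(t),X(t'))$.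 2. In the absence of stochastic volatility, i.e. if there is a constant $v\in\mathbb R$ with $\sigma(s)=v$ almost surely for every $s$, the fields $Z$ and $|\kappa|X$ have identical finite dimensional distributions; in particular, for $\kappa=\pm1$ the fields $Z$ and $X$ have identical finite dimensional distributions. -/

import Mathlib

open MeasureTheory ProbabilityTheory Filter Topology
open scoped ENNReal FourierTransform

namespace VMMMA

/-! ### Gaussian bases and the stochastic integral

Everything is set up over a measurable space `S` with a control measure `c` and a time coordinate
`τ : S → ℝ`; below `S` is `𝒳 × ℝ^d` or `ℝ^d`, and `τ` is the first coordinate of the `ℝ^d` part. -/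

section Noise

variable {Ω S : Type*} [mΩ : MeasurableSpace Ω] [MeasurableSpace S]

/-- `W` is a Gaussian independently scattered random measure with control measure `c`, indexed by
the measurable sets of finite measure: `W A` has law `N(0, c A)`, `W` is independent on disjoint
sets, and it is countably additive almost surely. -/
structure IsGaussianBasis (P : Measure Ω) (c : Measure S) (W : Set S → Ω → ℝ) : Prop where
  measurable : ∀ A, MeasurableSet A → c A < ∞ → Measurable (W A)
  law : ∀ A, MeasurableSet A → c A < ∞ → P.map (W A) = gaussianReal 0 (c A).toNNReal
  indep : ∀ A : ℕ → Set S, (∀ n, MeasurableSet (A n)) → (∀ n, c (A n) < ∞) →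
    Pairwise (Function.onFun Disjoint A) → iIndepFun (fun n => W (A n)) P
  additive : ∀ A : ℕ → Set S, (∀ n, MeasurableSet (A n)) → c (⋃ n, A n) < ∞ →
    Pairwise (Function.onFun Disjoint A) →
    ∀ᵐ ω ∂P, Tendsto (fun N : ℕ => ∑ n ∈ Finset.range N, W (A n) ω) atTop
      (𝓝 (W (⋃ n, A n) ω))

/-- The σ-algebra on `Ω` generated by the noise `W` inside the region `R` of `S`. -/
abbrev noiseAlgebra (c : Measure S) (W : Set S → Ω → ℝ) (R : Set S) : MeasurableSpace Ω :=
  ⨆ (A : Set S) (_ : MeasurableSet A ∧ c A < ∞ ∧ A ⊆ R),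
    MeasurableSpace.comap (W A) inferInstance

/-- The σ-algebra on `Ω` generated by a real random field. -/
abbrev fieldAlgebra {T : Type*} (σ : T → Ω → ℝ) : MeasurableSpace Ω :=
  ⨆ s, MeasurableSpace.comap (σ s) inferInstance

/-- The noise `W` is compatible with the filtration `ℱ`: at each time `r` its past is known and its
future is independent of `ℱ r`. (So `W` is a martingale measure for `ℱ`.) -/
structure IsCompatible (P : Measure Ω) (c : Measure S) (τ : S → ℝ) (ℱ : Filtration ℝ mΩ)
    (W : Set S → Ω → ℝ) : Prop where
  adapted : ∀ r, noiseAlgebra c W {z | τ z ≤ r} ≤ ℱ r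
  future : ∀ r, Indep (noiseAlgebra c W {z | r < τ z}) (ℱ r) P

/-- The predictable σ-algebra on `S × Ω`. -/
abbrev predictableAlgebra (τ : S → ℝ) (ℱ : Filtration ℝ mΩ) : MeasurableSpace (S × Ω) :=
  MeasurableSpace.generateFrom
    {C | ∃ (a b : ℝ) (A : Set S) (F : Set Ω), MeasurableSet A ∧ MeasurableSet[ℱ a] F ∧
      C = {z | z ∈ A ∧ a < τ z ∧ τ z ≤ b} ×ˢ F}

/-- An elementary integrand `ξ(ω) 1_A(z)`, with `A` a set of finite measure lying in the time strip
`(a, b]` and `ξ` bounded and known at time `a`. -/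
structure ElementaryIntegrand (c : Measure S) (τ : S → ℝ) (ℱ : Filtration ℝ mΩ) where
  a : ℝ
  b : ℝ
  A : Set S
  ξ : Ω → ℝ
  measurableSet : MeasurableSet A
  finite : c A < ∞
  strip : ∀ z ∈ A, a < τ z ∧ τ z ≤ b
  measurable : Measurable[ℱ a] ξ
  bounded : ∃ C, ∀ ω, |ξ ω| ≤ C

/-- The value of a simple integrand, a finite sum of elementary ones. -/
noncomputable def simpleValue {c : Measure S} {τ : S → ℝ} {ℱ : Filtration ℝ mΩ}
    (l : List (ElementaryIntegrand c τ ℱ)) (z : S) (ω : Ω) : ℝ :=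
  (l.map fun e => e.ξ ω * e.A.indicator (fun _ => (1 : ℝ)) z).sum

/-- The integral of a simple integrand: `ξ(ω) 1_A(z)` is sent to `ξ W(A)`. -/
def simpleIntegral {c : Measure S} {τ : S → ℝ} {ℱ : Filtration ℝ mΩ}
    (W : Set S → Ω → ℝ) (l : List (ElementaryIntegrand c τ ℱ)) (ω : Ω) : ℝ :=
  (l.map fun e => e.ξ ω * W e.A ω).sum

/-- `Y` is (a version of) the stochastic integral `∫ φ dW`: the `L²(P)`-limit of the integrals of
simple integrands which converge to `φ` in `L²(c ⊗ P)`. -/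
def IsStochIntegral (P : Measure Ω) (c : Measure S) (τ : S → ℝ) (ℱ : Filtration ℝ mΩ)
    (W : Set S → Ω → ℝ) (φ : S → Ω → ℝ) (Y : Ω → ℝ) : Prop :=
  MemLp Y 2 P ∧
  ∃ l : ℕ → List (ElementaryIntegrand c τ ℱ),
    Tendsto (fun n => eLpNorm (fun q : S × Ω => simpleValue (l n) q.1 q.2 - φ q.1 q.2) 2
      (c.prod P)) atTop (𝓝 0) ∧
    Tendsto (fun n => eLpNorm (fun ω => simpleIntegral W (l n) ω - Y ω) 2 P) atTop (𝓝 0)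

open Classical in
/-- The stochastic integral `∫ φ dW` (a version of it; `0` if `φ` is not integrable). -/
noncomputable def stochIntegral (P : Measure Ω) (c : Measure S) (τ : S → ℝ)
    (ℱ : Filtration ℝ mΩ) (W : Set S → Ω → ℝ) (φ : S → Ω → ℝ) : Ω → ℝ :=
  if h : ∃ Y, IsStochIntegral P c τ ℱ W φ Y then h.choose else 0

end Noise

/-! ### Random fields -/

section Fields

variable {Ω T : Type*} [MeasurableSpace Ω]

/-- Two real random fields on `Ω` have the same finite-dimensional distributions. -/
def SameFDD (P : Measure Ω) (X Y : T → Ω → ℝ) : Prop :=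
  ∀ (n : ℕ) (t : Fin n → T),
    IdentDistrib (fun ω i => X (t i) ω) (fun ω i => Y (t i) ω) P P

/-- Strict stationarity. -/
def StrictlyStationary [Add T] (P : Measure Ω) (X : T → Ω → ℝ) : Prop :=
  ∀ h : T, SameFDD P (fun t => X (t + h)) X

/-- The correlation of two real random variables. -/
noncomputable def correlation (P : Measure Ω) (X Y : Ω → ℝ) : ℝ :=
  covariance X Y P / (√(variance X P) * √(variance Y P))

end Fields

/-- `ℝ^d`. -/
abbrev Space (d : ℕ) := EuclideanSpace ℝ (Fin d)

/-- The time coordinate of a point of `ℝ^d`, `d ≥ 1`: its first coordinate. -/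
def time {d : ℕ} [NeZero d] (s : Space d) : ℝ := s 0

section MovingAverages

variable {d : ℕ} [NeZero d] {𝒳 : Type*} [MeasurableSpace 𝒳] {Ω : Type*} [mΩ : MeasurableSpace Ω]

/-- The integrand `(x, s) ↦ g(x, t - s) σ(s)`. -/
def mixedIntegrand (g : 𝒳 → Space d → ℝ) (σ : Space d → Ω → ℝ) (t : Space d)
    (z : 𝒳 × Space d) (ω : Ω) : ℝ :=
  g z.1 (t - z.2) * σ z.2 ω

/-- The integrand `s ↦ f(t - s) σ(s)`. -/
def integrand (f : Space d → ℝ) (σ : Space d → Ω → ℝ) (t : Space d)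
    (s : Space d) (ω : Ω) : ℝ :=
  f (t - s) * σ s ω

/-- The volatility modulated mixed moving average field
`X(t) = ∫ g(x, t - s) σ(s) W(dx, ds)`, for a noise with control measure `p(dx) ds`. -/
noncomputable def vmmma (P : Measure Ω) (p : Measure 𝒳) (ℱ : Filtration ℝ mΩ)
    (W : Set (𝒳 × Space d) → Ω → ℝ) (g : 𝒳 → Space d → ℝ) (σ : Space d → Ω → ℝ)
    (t : Space d) : Ω → ℝ :=
  stochIntegral P (p.prod volume) (fun z => time z.2) ℱ W (mixedIntegrand g σ t)

/-- The volatility modulated moving average field `Z(t) = ∫ f(t - s) σ(s) W(ds)`, for a noise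
whose control measure is Lebesgue measure. -/
noncomputable def vmma (P : Measure Ω) (ℱ : Filtration ℝ mΩ)
    (W : Set (Space d) → Ω → ℝ) (f : Space d → ℝ) (σ : Space d → Ω → ℝ)
    (t : Space d) : Ω → ℝ :=
  stochIntegral P volume time ℱ W (integrand f σ t)

end MovingAverages

/-! ### The `L²`-Fourier transform and `γ` -/

open Classical in
/-- The unitary `L²`-Fourier transform in angular frequency,
`(2π)^{-d/2} ∫ e^{-i u·s} f(s) ds` extended from `L¹ ∩ L²` to `L²`. Mathlib's transform on `L²`
extends `∫ e^{-2πi v·s} f(s) ds`; so it is taken at `v = u / (2π)`. -/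
noncomputable def l2Fourier {d : ℕ} (f : Space d → ℂ) (u : Space d) : ℂ :=
  if h : MemLp f 2 volume then
    (((2 * Real.pi) ^ (-(d : ℝ) / 2) : ℝ) : ℂ) *
      (𝓕 (h.toLp f) : Lp ℂ 2 (volume : Measure (Space d))) ((2 * Real.pi)⁻¹ • u)
  else 0

/-- `ĝ` is a jointly measurable version of `(x, u) ↦` the `L²`-Fourier transform of `g(x, ·)`
at `u`. -/
def IsPartialFourier {d : ℕ} {𝒳 : Type*} [MeasurableSpace 𝒳] (p : Measure 𝒳)
    (g : 𝒳 → Space d → ℝ) (ĝ : 𝒳 → Space d → ℂ) : Prop :=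
  Measurable (Function.uncurry ĝ) ∧
    ∀ᵐ x ∂p, ĝ x =ᵐ[volume] l2Fourier (fun s => (g x s : ℂ))

/-- `γ(u) = ∫ |ĝ(x, u)|² p(dx)`. -/
noncomputable def gammaFn {d : ℕ} {𝒳 : Type*} [MeasurableSpace 𝒳] (p : Measure 𝒳)
    (ĝ : 𝒳 → Space d → ℂ) (u : Space d) : ℝ :=
  ∫ x, ‖ĝ x u‖ ^ 2 ∂p

/-- The complex valued function `γ^{1/2}`. -/
noncomputable def gammaRoot {d : ℕ} {𝒳 : Type*} [MeasurableSpace 𝒳] (p : Measure 𝒳)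
    (ĝ : 𝒳 → Space d → ℂ) (u : Space d) : ℂ :=
  (√(gammaFn p ĝ u) : ℝ)

end VMMMA

/-! The Walsh integral is an isometry: the L²(P) norm of an integral is the L²(c ⊗ P) norm of its
integrand. By stationarity E σ(s)² does not depend on s, so for a deterministic kernel k the
integral of k·σ has norm ‖k‖ times the norm of σ(0). The integrals are centred, so polarisation
recovers Cov(X(t), X(t')) from the norms of X(t), X(t') and X(t) - X(t'). The covariance claim thus
reduces to two identities between kernels: passing from g to f multiplies by |κ| the norm of the
kernel at t (`eLpNorm_shift`) and that of the difference of the kernels at t and t'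
(`eLpNorm_shift_sub_shift`).

Both identities are Plancherel. For each x, the increment of g(x, ·) by a has transform (1 -
exp(i⟨a,u⟩)) ĝ(x,u) up to sign conventions that do not affect the modulus; integrating over x
replaces |ĝ|² by γ. On the other side f is κ times the transform of γ^{1/2}, so translating f means
modulating γ^{1/2}, and the same weight |1 - exp(i⟨a,u⟩)|² appears against γ. No Fourier inversion
is needed. The transform of γ^{1/2} is real because γ is even, each g(x, ·) being real valued.

Existence of the integrals is the density of simple integrands among square integrable predictable
ones, a π-λ argument (`isSimpleLimit_indicator`), combined with the isometry and completeness of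
L²(P).

For constant σ the integrands are deterministic, the integrals are L²-limits of centred Gaussians
and hence Gaussian, and so are all their linear combinations. Equality of covariances then gives
equality of finite dimensional distributions by the Cramér-Wold device (`sameFDD_of_gaussian`). -/

namespace VMMMA

/-! ### The unitary Fourier transform on `L²(ℝ^d)` -/

section Fourier

variable {d : ℕ}

open scoped RealInnerProductSpace

theorem map_smul_two_pi :
    Measure.map (fun u : Space d => (2 * Real.pi)⁻¹ • u) volume =
      ENNReal.ofReal ((2 * Real.pi) ^ d) • (volume : Measure (Space d)) := by
  rw [Measure.map_addHaar_smul _ (inv_ne_zero Real.two_pi_pos.ne')]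
  congr 2
  rw [finrank_euclideanSpace, Fintype.card_fin, inv_pow, inv_inv, abs_of_pos]
  have := Real.two_pi_pos
  positivity

theorem quasiMeasurePreserving_smul_two_pi :
    Measure.QuasiMeasurePreserving (fun u : Space d => (2 * Real.pi)⁻¹ • u) volume volume := by
  refine ⟨by fun_prop, ?_⟩
  rw [map_smul_two_pi]
  exact Measure.smul_absolutelyContinuous

theorem l2Fourier_of_memLp {h : Space d → ℂ} (hh : MemLp h 2 volume) :
    l2Fourier h = fun u => (((2 * Real.pi) ^ (-(d : ℝ) / 2) : ℝ) : ℂ) *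
      (𝓕 (hh.toLp h) : Lp ℂ 2 (volume : Measure (Space d))) ((2 * Real.pi)⁻¹ • u) := by
  funext u
  simp only [l2Fourier, hh, dif_pos]

theorem memLp_two_rescale {F : Space d → ℂ} (hF : MemLp F 2 volume) :
    MemLp (fun u => (((2 * Real.pi) ^ (-(d : ℝ) / 2) : ℝ) : ℂ) * F ((2 * Real.pi)⁻¹ • u))
      2 volume := by
  refine MemLp.const_mul ?_ _
  have h2 : MemLp F 2 (Measure.map (fun u : Space d => (2 * Real.pi)⁻¹ • u) volume) := by
    rw [map_smul_two_pi]
    exact hF.smul_measure ENNReal.ofReal_ne_top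
  exact h2.comp_of_map (by fun_prop)

/-- The Jacobian (2π)^d of the dilation enters the L² norm through its square root, which the
prefactor (2π)^{-d/2} cancels exactly. -/
theorem eLpNorm_two_rescale {F : Space d → ℂ} (hF : AEStronglyMeasurable F volume) :
    eLpNorm (fun u => (((2 * Real.pi) ^ (-(d : ℝ) / 2) : ℝ) : ℂ) * F ((2 * Real.pi)⁻¹ • u))
      2 volume = eLpNorm F 2 volume := by
  have h2 : AEStronglyMeasurable F
      (Measure.map (fun u : Space d => (2 * Real.pi)⁻¹ • u) volume) := by
    rw [map_smul_two_pi]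
    exact hF.smul_measure _
  have h3 := eLpNorm_map_measure (p := 2) h2 (by fun_prop)
  rw [map_smul_two_pi, eLpNorm_smul_measure_of_ne_top (by norm_num)] at h3
  have h4 := eLpNorm_const_smul (p := 2) (μ := (volume : Measure (Space d)))
    (((2 * Real.pi) ^ (-(d : ℝ) / 2) : ℝ) : ℂ)
    (F ∘ fun u : Space d => (2 * Real.pi)⁻¹ • u)
  rw [← h3] at h4
  refine Eq.trans h4 ?_
  have hpi := Real.two_pi_pos
  have e1 : ‖(((2 * Real.pi) ^ (-(d : ℝ) / 2) : ℝ) : ℂ)‖ₑ =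
      ENNReal.ofReal ((2 * Real.pi) ^ (-(d : ℝ) / 2)) := by
    rw [← ofReal_norm, Complex.norm_real, Real.norm_of_nonneg (by positivity)]
  rw [e1, ENNReal.ofReal_rpow_of_nonneg (by positivity) (by positivity), smul_eq_mul, ← mul_assoc,
    ← ENNReal.ofReal_mul (by positivity)]
  have e2 : (2 * Real.pi) ^ (-(d : ℝ) / 2) * ((2 * Real.pi) ^ d) ^ (1 / (2 : ℝ≥0∞)).toReal = 1 := by
    rw [← Real.rpow_natCast, ← Real.rpow_mul hpi.le, ← Real.rpow_add hpi]
    rw [show -(d : ℝ) / 2 + d * (1 / (2 : ℝ≥0∞)).toReal = 0 by norm_num; ring, Real.rpow_zero]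
  rw [e2]
  simp

theorem memLp_l2Fourier {h : Space d → ℂ} (hh : MemLp h 2 volume) :
    MemLp (l2Fourier h) 2 volume := by
  rw [l2Fourier_of_memLp hh]
  exact memLp_two_rescale (Lp.memLp _)

/-- Plancherel's theorem for the unitary Fourier transform in angular frequency. -/
theorem eLpNorm_l2Fourier {h : Space d → ℂ} (hh : MemLp h 2 volume) :
    eLpNorm (l2Fourier h) 2 volume = eLpNorm h 2 volume := by
  rw [l2Fourier_of_memLp hh, eLpNorm_two_rescale (Lp.aestronglyMeasurable _),
    ← Lp.enorm_def, ← eLpNorm_congr_ae hh.coeFn_toLp, ← Lp.enorm_def, ← ofReal_norm,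
    ← ofReal_norm, Lp.norm_fourier_eq]

theorem l2Fourier_congr {h k : Space d → ℂ} (hk : h =ᵐ[volume] k) : l2Fourier h = l2Fourier k := by
  by_cases hh : MemLp h 2 volume
  · have hk' : MemLp k 2 volume := (memLp_congr_ae hk).1 hh
    rw [l2Fourier_of_memLp hh, l2Fourier_of_memLp hk', (MemLp.toLp_eq_toLp_iff hh hk').2 hk]
  · have hk' : ¬ MemLp k 2 volume := fun h' => hh ((memLp_congr_ae hk).2 h')
    funext u
    simp only [l2Fourier, hh, hk', dif_neg, not_false_eq_true]

theorem l2Fourier_sub {h k : Space d → ℂ} (hh : MemLp h 2 volume) (hk : MemLp k 2 volume) :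
    l2Fourier (h - k) =ᵐ[volume] l2Fourier h - l2Fourier k := by
  rw [l2Fourier_of_memLp hh, l2Fourier_of_memLp hk, l2Fourier_of_memLp (hh.sub hk),
    MemLp.toLp_sub hh hk]
  have e : (𝓕 (hh.toLp h - hk.toLp k) : Lp ℂ 2 (volume : Measure (Space d))) =
      𝓕 (hh.toLp h) - 𝓕 (hk.toLp k) := (Lp.fourierTransformₗᵢ (Space d) ℂ).map_sub _ _
  rw [e]
  filter_upwards [quasiMeasurePreserving_smul_two_pi.ae (Lp.coeFn_sub (𝓕 (hh.toLp h) :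
    Lp ℂ 2 (volume : Measure (Space d))) (𝓕 (hk.toLp k)))] with u hu
  simp only [Pi.sub_apply, hu]
  ring

/-- The `L²`-Fourier transform of an integrable function is the classical one. -/
theorem fourier_toLp_ae_eq {h : Space d → ℂ} (hh : MemLp h 2 volume) (hi : Integrable h volume) :
    (𝓕 (hh.toLp h) : Lp ℂ 2 (volume : Measure (Space d))) =ᵐ[volume] 𝓕 h := by
  have hcont : Continuous (𝓕 h) := VectorFourier.fourierIntegral_continuous
    Real.continuous_fourierChar (by exact continuous_inner) hi
  -- Test against smooth compactly supported g. On either side the transform can be moved onto g: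
  -- for the L² transform because it agrees with the distributional one, for the classical transform
  -- by Fubini.
  refine ae_eq_of_integral_contDiff_smul_eq ((Lp.memLp _).locallyIntegrable (by norm_num))
    hcont.locallyIntegrable fun g hg hgc => ?_
  have hg₁ : HasCompactSupport (Complex.ofRealCLM ∘ g) := hgc.comp_left rfl
  have hg₂ : ContDiff ℝ ((⊤ : ℕ∞) : WithTop ℕ∞) (Complex.ofRealCLM ∘ g) := by fun_prop
  have key := congrArg (fun T => T (hg₁.toSchwartzMap hg₂))
    (Lp.fourier_toTemperedDistribution_eq (hh.toLp h))
  simp only [TemperedDistribution.fourier_apply, Lp.toTemperedDistribution_apply] at key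
  have k1 : ∫ x, g x • (𝓕 (hh.toLp h) : Lp ℂ 2 (volume : Measure (Space d))) x =
      ∫ x, (𝓕 (hg₁.toSchwartzMap hg₂)) x • h x := by
    refine Eq.trans ?_ (key.symm.trans ?_)
    · simp
    · refine integral_congr_ae ?_
      filter_upwards [hh.coeFn_toLp] with x hx
      rw [hx]
  rw [k1, SchwartzMap.fourier_coe]
  have := VectorFourier.integral_fourierIntegral_smul_eq_flip (μ := volume) (ν := volume)
    (L := innerₗ (Space d)) (f := hg₁.toSchwartzMap hg₂) (g := h) Real.continuous_fourierChar
    (by exact continuous_inner) (hg₁.toSchwartzMap hg₂).integrable hi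
  rw [flip_innerₗ] at this
  refine Eq.trans this ?_
  simp
  rfl

/-- The classical unitary Fourier transform in angular frequency. -/
noncomputable def angularFourier (h : Space d → ℂ) (u : Space d) : ℂ :=
  (((2 * Real.pi) ^ (-(d : ℝ) / 2) : ℝ) : ℂ) *
    ∫ s, Complex.exp ((-⟪s, u⟫ : ℝ) * Complex.I) * h s

theorem l2Fourier_ae_eq_angularFourier {h : Space d → ℂ} (hh : MemLp h 2 volume)
    (hi : Integrable h volume) : l2Fourier h =ᵐ[volume] angularFourier h := by
  rw [l2Fourier_of_memLp hh]
  filter_upwards [quasiMeasurePreserving_smul_two_pi.ae (fourier_toLp_ae_eq hh hi)] with u hu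
  rw [hu, angularFourier, Real.fourier_eq']
  congr 2
  funext s
  rw [smul_eq_mul, inner_smul_right]
  congr 4
  field_simp

/-- The operator `h ↦ e · c(h ∘ A)`. -/
noncomputable def twist (e : Space d → ℂ) (c : ℂ →ₗᵢ[ℝ] ℂ) (A : Space d → Space d) (h : Space d → ℂ) :
    Space d → ℂ :=
  fun s => e s * c (h (A s))

theorem twist_def (e : Space d → ℂ) (c : ℂ →ₗᵢ[ℝ] ℂ) (A : Space d → Space d) (h : Space d → ℂ) :
    twist e c A h = fun s => e s * c (h (A s)) := rfl

section Twist

variable {e : Space d → ℂ} {c : ℂ →ₗᵢ[ℝ] ℂ} {A : Space d → Space d}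

theorem twist_sub (h k : Space d → ℂ) : twist e c A (h - k) = twist e c A h - twist e c A k := by
  funext s
  simp [twist, mul_sub]

variable (he : Continuous e) (he1 : ∀ s, ‖e s‖ = 1) (hA : MeasurePreserving A)

include he hA in
theorem aestronglyMeasurable_twist {h : Space d → ℂ} (hh : AEStronglyMeasurable h volume) :
    AEStronglyMeasurable (twist e c A h) volume :=
  he.aestronglyMeasurable.mul
    (c.continuous.comp_aestronglyMeasurable (hh.comp_measurePreserving hA))

include he1 hA in
theorem eLpNorm_twist {h : Space d → ℂ} (q : ℝ≥0∞) (hh : AEStronglyMeasurable h volume) :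
    eLpNorm (twist e c A h) q volume = eLpNorm h q volume := by
  rw [← eLpNorm_comp_measurePreserving hh hA]
  refine eLpNorm_congr_norm_ae (Eventually.of_forall fun s => ?_)
  simp [twist, he1]

include he he1 hA in
theorem memLp_twist {h : Space d → ℂ} {q : ℝ≥0∞} (hh : MemLp h q volume) :
    MemLp (twist e c A h) q volume :=
  ⟨aestronglyMeasurable_twist he hA hh.1, by rw [eLpNorm_twist he1 hA q hh.1]; exact hh.2⟩

include hA in
theorem twist_congr {h k : Space d → ℂ} (hk : h =ᵐ[volume] k) :
    twist e c A h =ᵐ[volume] twist e c A k := by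
  filter_upwards [hA.quasiMeasurePreserving.ae hk] with s hs
  simp [twist, hs]

end Twist

/-- An intertwining relation between twists that the classical Fourier transform satisfies on
integrable functions extends to `L²`. -/
theorem l2Fourier_twist {e e' : Space d → ℂ} {c c' : ℂ →ₗᵢ[ℝ] ℂ} {A A' : Space d → Space d}
    (he : Continuous e) (he1 : ∀ s, ‖e s‖ = 1) (hA : MeasurePreserving A)
    (he' : Continuous e') (he1' : ∀ s, ‖e' s‖ = 1) (hA' : MeasurePreserving A')
    (H : ∀ h : Space d → ℂ, angularFourier (twist e c A h) = twist e' c' A' (angularFourier h))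
    {h : Space d → ℂ} (hh : MemLp h 2 volume) :
    l2Fourier (twist e c A h) =ᵐ[volume] twist e' c' A' (l2Fourier h) := by
  set D := l2Fourier (twist e c A h) - twist e' c' A' (l2Fourier h) with hD
  have hTh := memLp_twist (c := c) he he1 hA hh
  have hMh := memLp_twist (c := c') he' he1' hA' (memLp_l2Fourier hh)
  suffices hz : eLpNorm D 2 volume = 0 by
    have h0 := (eLpNorm_eq_zero_iff ((memLp_l2Fourier hTh).sub hMh).1 (by norm_num)).1 hz
    filter_upwards [h0] with u hu
    exact sub_eq_zero.1 hu
  refine le_antisymm (ENNReal.le_of_forall_pos_le_add fun ε hε _ => ?_) bot_le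
  rw [zero_add]
  -- A continuous compactly supported φ lies in L¹ ∩ L², where the classical relation `H` applies.
  obtain ⟨φ, hφc, hφ, hφcont, hφ2⟩ := hh.exists_hasCompactSupport_eLpNorm_sub_le (by norm_num)
    (ε := (ε : ℝ≥0∞) / 2) (by simp [hε.ne'])
  have hφi : Integrable φ := hφcont.integrable_of_hasCompactSupport hφc
  have hTφ := memLp_twist (c := c) he he1 hA hφ2
  have hTφi : Integrable (twist e c A φ) :=
    memLp_one_iff_integrable.1 (memLp_twist he he1 hA (memLp_one_iff_integrable.2 hφi))
  have e1 : l2Fourier (twist e c A φ) =ᵐ[volume] twist e' c' A' (l2Fourier φ) := by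
    refine (l2Fourier_ae_eq_angularFourier hTφ hTφi).trans ?_
    rw [H]
    exact twist_congr hA' (l2Fourier_ae_eq_angularFourier hφ2 hφi).symm
  -- The defect is additive and vanishes at φ, so it is the defect of h - φ; each of its two terms
  -- has the norm of h - φ, at most ε/2.
  have e2 : D =ᵐ[volume] l2Fourier (twist e c A (h - φ)) -
      twist e' c' A' (l2Fourier (h - φ)) := by
    have a1 := l2Fourier_sub hTh hTφ
    rw [← twist_sub] at a1
    have a2 := twist_congr (e := e') (c := c') hA' (l2Fourier_sub hh hφ2)
    rw [twist_sub] at a2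
    filter_upwards [a1, a2, e1] with u h1 h2 h3
    simp only [hD, Pi.sub_apply] at h1 h2 ⊢
    rw [h1, h2, h3]
    ring
  have hd := hh.sub hφ2
  have hTd := memLp_twist (c := c) he he1 hA hd
  have hMd := memLp_twist (c := c') he' he1' hA' (memLp_l2Fourier hd)
  rw [eLpNorm_congr_ae e2]
  refine (eLpNorm_sub_le (memLp_l2Fourier hTd).1 hMd.1 (by norm_num)).trans ?_
  rw [eLpNorm_l2Fourier hTd, eLpNorm_twist he1 hA 2 hd.1,
    eLpNorm_twist he1' hA' 2 (memLp_l2Fourier hd).1, eLpNorm_l2Fourier hd]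
  exact (add_le_add hφ hφ).trans (ENNReal.add_halves _).le

/-- The substitution s ↦ s - a in the classical integral pulls out the phase. This serves the
sections g(x, ·). -/
theorem l2Fourier_translate (a : Space d) {h : Space d → ℂ} (hh : MemLp h 2 volume) :
    l2Fourier (fun s => h (s + a)) =ᵐ[volume]
      fun u => Complex.exp ((⟪a, u⟫ : ℝ) * Complex.I) * l2Fourier h u := by
  have := l2Fourier_twist (e := fun _ => 1) (c := LinearIsometry.id) (A := fun s => s + a)
    (e' := fun u => Complex.exp ((⟪a, u⟫ : ℝ) * Complex.I)) (c' := LinearIsometry.id)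
    (A' := id) continuous_const (by simp) (measurePreserving_add_right _ _)
    (by fun_prop) (fun u => Complex.norm_exp_ofReal_mul_I _) (MeasurePreserving.id _) ?_ hh
  · simpa [twist_def] using this
  · intro h
    funext u
    simp only [angularFourier, twist, LinearIsometry.id_apply, one_mul, id_eq]
    rw [mul_left_comm]
    congr 1
    rw [← integral_const_mul]
    refine Eq.trans ?_ (integral_add_right_eq_self (fun s => Complex.exp ((⟪a, u⟫ : ℝ) * Complex.I) *
      (Complex.exp ((-⟪s, u⟫ : ℝ) * Complex.I) * h s)) a)
    congr 1
    funext s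
    rw [← mul_assoc, ← Complex.exp_add, inner_add_left]
    congr 2
    push_cast
    ring

/-- The dual rule: it serves f, which is itself a transform, so that its translates come from
modulating γ^{1/2}. -/
theorem l2Fourier_modulate (a : Space d) {h : Space d → ℂ} (hh : MemLp h 2 volume) :
    l2Fourier (fun s => Complex.exp ((-⟪s, a⟫ : ℝ) * Complex.I) * h s) =ᵐ[volume]
      fun u => l2Fourier h (u + a) := by
  have := l2Fourier_twist (e := fun s => Complex.exp ((-⟪s, a⟫ : ℝ) * Complex.I))
    (c := LinearIsometry.id) (A := id) (e' := fun _ => 1) (c' := LinearIsometry.id)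
    (A' := fun s => s + a) (by fun_prop) (fun u => Complex.norm_exp_ofReal_mul_I _)
    (MeasurePreserving.id _) continuous_const (by simp) (measurePreserving_add_right _ _) ?_ hh
  · simpa [twist_def] using this
  · intro h
    funext u
    simp only [angularFourier, twist, LinearIsometry.id_apply, one_mul, id_eq]
    congr 2
    funext s
    rw [← mul_assoc, ← Complex.exp_add, inner_add_right]
    congr 2
    push_cast
    ring

theorem l2Fourier_comp_neg {h : Space d → ℂ} (hh : MemLp h 2 volume) :
    l2Fourier (fun s => h (-s)) =ᵐ[volume] fun u => l2Fourier h (-u) := by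
  have := l2Fourier_twist (e := fun _ => 1) (c := LinearIsometry.id) (A := fun s => -s)
    (e' := fun _ => 1) (c' := LinearIsometry.id) (A' := fun s => -s) continuous_const (by simp)
    (Measure.measurePreserving_neg _) continuous_const (by simp)
    (Measure.measurePreserving_neg _) ?_ hh
  · simpa [twist_def] using this
  · intro h
    funext u
    simp only [angularFourier, twist, LinearIsometry.id_apply, one_mul]
    congr 1
    refine Eq.trans ?_ (integral_neg_eq_self (fun s =>
      Complex.exp ((-⟪s, -u⟫ : ℝ) * Complex.I) * h s) _)
    simp

theorem l2Fourier_conj {h : Space d → ℂ} (hh : MemLp h 2 volume) :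
    l2Fourier (fun s => (starRingEnd ℂ) (h s)) =ᵐ[volume]
      fun u => (starRingEnd ℂ) (l2Fourier h (-u)) := by
  have := l2Fourier_twist (e := fun _ => 1) (c := Complex.conjLIE.toLinearIsometry) (A := id)
    (e' := fun _ => 1) (c' := Complex.conjLIE.toLinearIsometry) (A' := fun s => -s)
    continuous_const (by simp) (MeasurePreserving.id _) continuous_const (by simp)
    (Measure.measurePreserving_neg _) ?_ hh
  · simpa [twist_def] using this
  · intro h
    funext u
    simp only [angularFourier, twist, LinearIsometryEquiv.coe_toLinearIsometry,
      Complex.conjLIE_apply, one_mul, map_mul, id_eq, Complex.conj_ofReal, ← integral_conj,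
      ← Complex.exp_conj, Complex.conj_I, inner_neg_right]
    congr 2
    funext s
    congr 2
    push_cast
    ring

end Fourier

theorem eLpNorm_two_sq {α E : Type*} [MeasurableSpace α] [NormedAddCommGroup E] (f : α → E)
    (μ : Measure α) : eLpNorm f 2 μ ^ 2 = ∫⁻ x, ‖f x‖ₑ ^ 2 ∂μ := by
  have := eLpNorm_nnreal_pow_eq_lintegral (f := f) (p := 2) (μ := μ) (by norm_num)
  simpa only [NNReal.coe_ofNat, ENNReal.coe_ofNat, ENNReal.rpow_ofNat] using this

/-! ### The function `γ` -/

section Gamma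

open scoped RealInnerProductSpace

variable {d : ℕ} {𝒳 : Type*} [MeasurableSpace 𝒳] {p : Measure 𝒳}
  {g : 𝒳 → Space d → ℝ} {ĝ : 𝒳 → Space d → ℂ}

theorem ae_memLp_section (hg : MemLp (Function.uncurry g) 2 (p.prod volume)) :
    ∀ᵐ x ∂p, MemLp (fun s => (g x s : ℂ)) 2 volume := by
  have h1 : ∫⁻ z, ‖Function.uncurry g z‖ₑ ^ 2 ∂(p.prod volume) < ∞ := by
    rw [← eLpNorm_two_sq]
    exact ENNReal.pow_lt_top hg.2
  have hm : AEMeasurable (fun z => ‖Function.uncurry g z‖ₑ ^ 2) (p.prod volume) :=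
    hg.1.enorm.pow_const 2
  rw [lintegral_prod _ hm] at h1
  filter_upwards [ae_lt_top' hm.lintegral_prod_right' h1.ne, hg.1.prodMk_left] with x hx hx'
  refine MemLp.ofReal (K := ℂ) ⟨hx', ?_⟩
  have : eLpNorm (g x) 2 volume ^ 2 < ∞ := by rw [eLpNorm_two_sq]; exact hx
  simpa using this

/-- Tonelli splits the squared norm into sections, and Plancherel in each section turns the
increment into a multiplier. -/
theorem lintegral_enorm_mul_section_sub (hg_meas : Measurable (Function.uncurry g))
    (hg : MemLp (Function.uncurry g) 2 (p.prod volume)) (hĝ : IsPartialFourier p g ĝ)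
    (a : Space d) :
    eLpNorm (fun z : 𝒳 × Space d => g z.1 z.2 - g z.1 (z.2 + a)) 2 (p.prod volume) ^ 2 =
      ∫⁻ x, (∫⁻ u, ‖(1 - Complex.exp ((⟪a, u⟫ : ℝ) * Complex.I)) * ĝ x u‖ₑ ^ 2) ∂p := by
  have hm : Measurable fun z : 𝒳 × Space d => g z.1 z.2 - g z.1 (z.2 + a) :=
    hg_meas.sub (hg_meas.comp (measurable_fst.prodMk (measurable_snd.add_const a)))
  rw [eLpNorm_two_sq, lintegral_prod _ (by fun_prop)]
  refine lintegral_congr_ae ?_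
  filter_upwards [ae_memLp_section hg, hĝ.2] with x hx hx'
  have hxa : MemLp (fun s => (g x (s + a) : ℂ)) 2 volume :=
    hx.comp_measurePreserving (measurePreserving_add_right volume a)
  have e1 : l2Fourier ((fun s => (g x s : ℂ)) - fun s => (g x (s + a) : ℂ)) =ᵐ[volume]
      fun u => (1 - Complex.exp ((⟪a, u⟫ : ℝ) * Complex.I)) * ĝ x u := by
    filter_upwards [l2Fourier_sub hx hxa, l2Fourier_translate a hx, hx'] with u h1 h2 h3
    rw [h1, Pi.sub_apply, h2, h3]
    ring
  have e2 := eLpNorm_l2Fourier (hx.sub hxa)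
  rw [eLpNorm_congr_ae e1] at e2
  rw [← eLpNorm_two_sq, ← eLpNorm_two_sq, e2]
  congr 1
  refine eLpNorm_congr_norm_ae (Eventually.of_forall fun s => ?_)
  simp only [Pi.sub_apply, ← Complex.ofReal_sub, Complex.norm_real]

theorem lintegral_enorm_section (hg_meas : Measurable (Function.uncurry g))
    (hg : MemLp (Function.uncurry g) 2 (p.prod volume)) (hĝ : IsPartialFourier p g ĝ) :
    eLpNorm (fun z : 𝒳 × Space d => g z.1 z.2) 2 (p.prod volume) ^ 2 =
      ∫⁻ x, (∫⁻ u, ‖ĝ x u‖ₑ ^ 2) ∂p := by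
  have hm : Measurable fun z : 𝒳 × Space d => ‖g z.1 z.2‖ₑ ^ 2 := hg_meas.enorm.pow_const 2
  rw [eLpNorm_two_sq, lintegral_prod _ hm.aemeasurable]
  refine lintegral_congr_ae ?_
  filter_upwards [ae_memLp_section hg, hĝ.2] with x hx hx'
  rw [← eLpNorm_two_sq, ← eLpNorm_two_sq, eLpNorm_congr_ae hx', eLpNorm_l2Fourier hx]
  congr 1
  refine eLpNorm_congr_norm_ae (Eventually.of_forall fun s => ?_)
  simp only [Complex.norm_real]

theorem gammaFn_nonneg (u : Space d) : 0 ≤ gammaFn p ĝ u :=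
  integral_nonneg fun _ => by positivity

variable [IsProbabilityMeasure p]

theorem measurable_gammaFn (hĝ : Measurable (Function.uncurry ĝ)) : Measurable (gammaFn p ĝ) := by
  have : StronglyMeasurable fun z : 𝒳 × Space d => ‖ĝ z.1 z.2‖ ^ 2 :=
    (hĝ.norm.pow_const 2).stronglyMeasurable
  exact this.integral_prod_left'.measurable

theorem measurable_gammaRoot (hĝ : Measurable (Function.uncurry ĝ)) :
    Measurable (gammaRoot p ĝ) :=
  Complex.measurable_ofReal.comp (measurable_gammaFn hĝ).sqrt

/-- `gammaFn` is a Bochner integral, hence 0 at any u where |ĝ(·,u)|² is not integrable. By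
Plancherel and Tonelli the double integral of |ĝ|² is finite, so such u form a null set. -/
theorem enorm_gammaRoot_sq (hg_meas : Measurable (Function.uncurry g))
    (hg : MemLp (Function.uncurry g) 2 (p.prod volume)) (hĝ : IsPartialFourier p g ĝ) :
    ∀ᵐ u : Space d, ‖gammaRoot p ĝ u‖ₑ ^ 2 = ∫⁻ x, ‖ĝ x u‖ₑ ^ 2 ∂p := by
  have hm : Measurable fun z : 𝒳 × Space d => ‖ĝ z.1 z.2‖ₑ ^ 2 := hĝ.1.enorm.pow_const 2
  have h1 : ∫⁻ u, ∫⁻ x, ‖ĝ x u‖ₑ ^ 2 ∂p < ∞ := by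
    rw [← lintegral_lintegral_swap (f := fun x u => ‖ĝ x u‖ₑ ^ 2) hm.aemeasurable,
      ← lintegral_enorm_section hg_meas hg hĝ]
    exact ENNReal.pow_lt_top hg.2
  filter_upwards [ae_lt_top hm.lintegral_prod_left' h1.ne] with u hu
  have hmu : Measurable fun x => ĝ x u := hĝ.1.comp (measurable_id.prodMk measurable_const)
  have e : ∀ x, ‖ĝ x u‖ₑ ^ 2 = ENNReal.ofReal (‖ĝ x u‖ ^ 2) := fun x => by
    rw [ENNReal.ofReal_pow (norm_nonneg _), ofReal_norm]
  have hi : Integrable (fun x => ‖ĝ x u‖ ^ 2) p := by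
    refine ⟨(hmu.norm.pow_const 2).aestronglyMeasurable, ?_⟩
    rw [hasFiniteIntegral_iff_ofReal (Eventually.of_forall fun x => by positivity)]
    simpa only [e] using hu
  simp only [e]
  rw [← ofReal_integral_eq_lintegral_ofReal hi (Eventually.of_forall fun x => by positivity),
    gammaRoot, ← ofReal_norm, Complex.norm_real, Real.norm_of_nonneg (Real.sqrt_nonneg _),
    ← ENNReal.ofReal_pow (Real.sqrt_nonneg _), Real.sq_sqrt (gammaFn_nonneg u), gammaFn]

/-- Here the variable x is integrated out. The weight w is later either 1 or 1 - exp(i⟨a,u⟩). -/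
theorem eLpNorm_mul_gammaRoot_sq (hg_meas : Measurable (Function.uncurry g))
    (hg : MemLp (Function.uncurry g) 2 (p.prod volume)) (hĝ : IsPartialFourier p g ĝ)
    {w : Space d → ℂ} (hw : Measurable w) :
    eLpNorm (fun u => w u * gammaRoot p ĝ u) 2 volume ^ 2 =
      ∫⁻ x, (∫⁻ u, ‖w u * ĝ x u‖ₑ ^ 2) ∂p := by
  have hm : Measurable fun z : 𝒳 × Space d => ‖w z.2 * ĝ z.1 z.2‖ₑ ^ 2 :=
    ((hw.comp measurable_snd).mul hĝ.1).enorm.pow_const 2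
  rw [eLpNorm_two_sq, lintegral_lintegral_swap (f := fun x u => ‖w u * ĝ x u‖ₑ ^ 2)
    hm.aemeasurable]
  refine lintegral_congr_ae ?_
  filter_upwards [enorm_gammaRoot_sq hg_meas hg hĝ] with u hu
  have hmu : Measurable fun x => ĝ x u := hĝ.1.comp (measurable_id.prodMk measurable_const)
  simp only [enorm_mul, mul_pow]
  rw [hu, lintegral_const_mul _ (by fun_prop)]

theorem eLpNorm_section_eq_gammaRoot (hg_meas : Measurable (Function.uncurry g))
    (hg : MemLp (Function.uncurry g) 2 (p.prod volume)) (hĝ : IsPartialFourier p g ĝ) :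
    eLpNorm (fun z : 𝒳 × Space d => g z.1 z.2) 2 (p.prod volume) =
      eLpNorm (gammaRoot p ĝ) 2 volume := by
  have := eLpNorm_mul_gammaRoot_sq hg_meas hg hĝ (w := fun _ => 1) measurable_const
  simp only [one_mul] at this
  rw [← lintegral_enorm_section hg_meas hg hĝ] at this
  exact ((ENNReal.pow_right_strictMono two_ne_zero).injective this).symm

theorem memLp_gammaRoot (hg_meas : Measurable (Function.uncurry g))
    (hg : MemLp (Function.uncurry g) 2 (p.prod volume)) (hĝ : IsPartialFourier p g ĝ) :
    MemLp (gammaRoot p ĝ) 2 volume :=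
  ⟨(measurable_gammaRoot hĝ.1).aestronglyMeasurable, by
    rw [← eLpNorm_section_eq_gammaRoot hg_meas hg hĝ]; exact hg.2⟩

/-- Since g(x, ·) is real, ĝ(x,-u) is the conjugate of ĝ(x,u), and the moduli agree. -/
theorem gammaFn_neg (hg : MemLp (Function.uncurry g) 2 (p.prod volume))
    (hĝ : IsPartialFourier p g ĝ) : ∀ᵐ u : Space d, gammaFn p ĝ (-u) = gammaFn p ĝ u := by
  have h1 : ∀ᵐ x ∂p, ∀ᵐ u : Space d, ‖ĝ x (-u)‖ = ‖ĝ x u‖ := by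
    filter_upwards [ae_memLp_section hg, hĝ.2] with x hx hx'
    have e1 := l2Fourier_conj hx
    simp only [Complex.conj_ofReal] at e1
    have hx'' := (Measure.measurePreserving_neg (volume : Measure (Space d))
      ).quasiMeasurePreserving.ae hx'
    filter_upwards [e1, hx', hx''] with u h1 h2 h3
    rw [h3, h2, h1, RCLike.norm_conj]
  have hmn : Measurable fun z : 𝒳 × Space d => ‖ĝ z.1 (-z.2)‖ :=
    (hĝ.1.comp (measurable_fst.prodMk measurable_snd.neg)).norm
  -- The exceptional set of u depends on x; joint measurability of ĝ allows passing through the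
  -- product measure to exchange the two "almost every".
  have h2 : ∀ᵐ z ∂(volume : Measure (Space d)).prod p, ‖ĝ z.2 (-z.1)‖ = ‖ĝ z.2 z.1‖ := by
    rw [← Measure.prod_swap, ae_map_iff measurable_swap.aemeasurable]
    · rw [Measure.ae_prod_iff_ae_ae]
      · exact h1
      · exact measurableSet_eq_fun hmn hĝ.1.norm
    · exact measurableSet_eq_fun (hmn.comp measurable_swap) (hĝ.1.norm.comp measurable_swap)
  filter_upwards [Measure.ae_ae_of_ae_prod h2] with u hu
  refine integral_congr_ae ?_
  filter_upwards [hu] with x hx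
  simp only [hx]

/-- Write F for the transform of γ^{1/2}. As γ^{1/2} is real, F(s) is the conjugate of F(-s); as it
is even, F(s) = F(-s). So F equals its own conjugate. -/
theorem l2Fourier_gammaRoot_im (hg_meas : Measurable (Function.uncurry g))
    (hg : MemLp (Function.uncurry g) 2 (p.prod volume)) (hĝ : IsPartialFourier p g ĝ) :
    ∀ᵐ s : Space d, (l2Fourier (gammaRoot p ĝ) s).im = 0 := by
  have hγ := memLp_gammaRoot hg_meas hg hĝ
  have e1 := l2Fourier_conj hγ
  have c1 : (fun s => (starRingEnd ℂ) (gammaRoot p ĝ s)) = gammaRoot p ĝ := by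
    funext s
    simp [gammaRoot]
  rw [c1] at e1
  have e2 := l2Fourier_comp_neg hγ
  have c2 : (fun s => gammaRoot p ĝ (-s)) =ᵐ[volume] gammaRoot p ĝ := by
    filter_upwards [gammaFn_neg hg hĝ] with s hs
    simp only [gammaRoot, hs]
  rw [l2Fourier_congr c2] at e2
  filter_upwards [e1, e2] with s h1 h2
  rw [← h2] at h1
  exact Complex.conj_eq_iff_im.1 h1.symm

variable {f : Space d → ℝ} {κ : ℝ}

omit [IsProbabilityMeasure p] in
theorem eLpNorm_eq_const_mul_gammaRoot (hγ : MemLp (gammaRoot p ĝ) 2 volume)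
    (hf : ∀ᵐ s : Space d, (f s : ℂ) = (κ : ℂ) * l2Fourier (gammaRoot p ĝ) s) :
    eLpNorm f 2 volume = ‖κ‖ₑ * eLpNorm (gammaRoot p ĝ) 2 volume := by
  rw [← eLpNorm_l2Fourier hγ, ← eLpNorm_const_smul]
  refine eLpNorm_congr_norm_ae ?_
  filter_upwards [hf] with s hs
  rw [← Complex.norm_real, hs]
  simp

-- The increment of f is κ times the transform of γ^{1/2} minus a modulation of it, so Plancherel
-- applies.
omit [IsProbabilityMeasure p] in
theorem eLpNorm_sub_translate_eq_const_mul (hγ : MemLp (gammaRoot p ĝ) 2 volume)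
    (hf : ∀ᵐ s : Space d, (f s : ℂ) = (κ : ℂ) * l2Fourier (gammaRoot p ĝ) s) (a : Space d) :
    eLpNorm (fun s => f s - f (s + a)) 2 volume = ‖κ‖ₑ *
      eLpNorm (fun u => (1 - Complex.exp ((⟪a, u⟫ : ℝ) * Complex.I)) * gammaRoot p ĝ u)
        2 volume := by
  have hmod : MemLp (fun u => Complex.exp ((-⟪u, a⟫ : ℝ) * Complex.I) * gammaRoot p ĝ u)
      2 volume := by
    refine (memLp_congr_norm (((by fun_prop : Continuous fun u : Space d =>
      Complex.exp ((-⟪u, a⟫ : ℝ) * Complex.I)).aestronglyMeasurable).mul hγ.1) hγ.1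
      (Eventually.of_forall fun u => ?_)).2 hγ
    rw [Pi.mul_apply, norm_mul, Complex.norm_exp_ofReal_mul_I, one_mul]
  have e1 : eLpNorm (fun u => (1 - Complex.exp ((⟪a, u⟫ : ℝ) * Complex.I)) * gammaRoot p ĝ u)
      2 volume = eLpNorm (gammaRoot p ĝ -
        fun u => Complex.exp ((-⟪u, a⟫ : ℝ) * Complex.I) * gammaRoot p ĝ u) 2 volume := by
    refine eLpNorm_congr_norm_ae (Eventually.of_forall fun u => ?_)
    -- Modulation brings in exp(-i⟨u,a⟩), the weight has exp(i⟨a,u⟩): the two factors are conjugate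
    -- and have equal modulus.
    rw [Pi.sub_apply, ← one_sub_mul, norm_mul, norm_mul,
      ← RCLike.norm_conj (1 - Complex.exp ((⟪a, u⟫ : ℝ) * Complex.I))]
    congr 2
    rw [map_sub, map_one, ← Complex.exp_conj, map_mul, Complex.conj_ofReal, Complex.conj_I,
      real_inner_comm]
    push_cast
    rw [mul_neg, neg_mul]
  rw [e1, ← eLpNorm_l2Fourier (hγ.sub hmod), ← eLpNorm_const_smul]
  refine eLpNorm_congr_norm_ae ?_
  filter_upwards [hf, (measurePreserving_add_right volume a).quasiMeasurePreserving.ae hf,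
    l2Fourier_sub hγ hmod, l2Fourier_modulate a hγ] with s h1 h2 h3 h4
  rw [← Complex.norm_real, Complex.ofReal_sub, h1, h2, Pi.smul_apply, h3, Pi.sub_apply, h4,
    ← mul_sub]
  simp

omit [IsProbabilityMeasure p] in
theorem memLp_of_ae_eq_l2Fourier (hγ : MemLp (gammaRoot p ĝ) 2 volume) (hf_meas : Measurable f)
    (hf : ∀ᵐ s : Space d, (f s : ℂ) = (κ : ℂ) * l2Fourier (gammaRoot p ĝ) s) :
    MemLp f 2 volume :=
  ⟨hf_meas.aestronglyMeasurable, by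
    rw [eLpNorm_eq_const_mul_gammaRoot hγ hf]
    exact ENNReal.mul_lt_top enorm_lt_top hγ.2⟩

theorem measurePreserving_sub_snd (t : Space d) :
    MeasurePreserving (fun z : 𝒳 × Space d => (z.1, t - z.2)) (p.prod volume) (p.prod volume) :=
  (MeasurePreserving.id p).prod (Measure.measurePreserving_sub_left volume t)

theorem eLpNorm_shift (hg_meas : Measurable (Function.uncurry g))
    (hg : MemLp (Function.uncurry g) 2 (p.prod volume)) (hĝ : IsPartialFourier p g ĝ)
    (hf_meas : Measurable f)
    (hf : ∀ᵐ s : Space d, (f s : ℂ) = (κ : ℂ) * l2Fourier (gammaRoot p ĝ) s) (t : Space d) :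
    eLpNorm (fun s => f (t - s)) 2 volume =
      ‖κ‖ₑ * eLpNorm (fun z : 𝒳 × Space d => g z.1 (t - z.2)) 2 (p.prod volume) := by
  have h1 := eLpNorm_comp_measurePreserving (p := 2) hf_meas.aestronglyMeasurable
    (Measure.measurePreserving_sub_left volume t)
  have h2 := eLpNorm_comp_measurePreserving (p := 2) hg_meas.aestronglyMeasurable
    (measurePreserving_sub_snd (p := p) t)
  refine h1.trans (Eq.trans ?_ (congrArg _ h2.symm))
  rw [eLpNorm_eq_const_mul_gammaRoot (memLp_gammaRoot hg_meas hg hĝ) hf,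
    ← eLpNorm_section_eq_gammaRoot hg_meas hg hĝ]
  rfl

/-- The reflection s ↦ t - s preserves the measures and reduces both differences to increments by a
= t' - t. On the Fourier side both are then weighted by 1 - exp(i⟨a,u⟩), against γ^{1/2} for f and
against ĝ for g. -/
theorem eLpNorm_shift_sub_shift (hg_meas : Measurable (Function.uncurry g))
    (hg : MemLp (Function.uncurry g) 2 (p.prod volume)) (hĝ : IsPartialFourier p g ĝ)
    (hf_meas : Measurable f)
    (hf : ∀ᵐ s : Space d, (f s : ℂ) = (κ : ℂ) * l2Fourier (gammaRoot p ĝ) s) (t t' : Space d) :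
    eLpNorm (fun s => f (t - s) - f (t' - s)) 2 volume =
      ‖κ‖ₑ * eLpNorm (fun z : 𝒳 × Space d => g z.1 (t - z.2) - g z.1 (t' - z.2)) 2
        (p.prod volume) := by
  have hgm : Measurable fun z : 𝒳 × Space d => g z.1 z.2 - g z.1 (z.2 + (t' - t)) :=
    hg_meas.sub (hg_meas.comp (measurable_fst.prodMk (measurable_snd.add_const _)))
  have h1 := eLpNorm_comp_measurePreserving (p := 2) (g := fun s => f s - f (s + (t' - t)))
    (hf_meas.sub (hf_meas.comp (measurable_add_const _))).aestronglyMeasurable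
    (Measure.measurePreserving_sub_left volume t)
  have h2 := eLpNorm_comp_measurePreserving (p := 2) hgm.aestronglyMeasurable
    (measurePreserving_sub_snd (p := p) t)
  have hs : ∀ s : Space d, t - s + (t' - t) = t' - s := fun s => by abel
  simp only [Function.comp_def, hs] at h1 h2
  rw [h1, h2, eLpNorm_sub_translate_eq_const_mul (memLp_gammaRoot hg_meas hg hĝ) hf]
  congr 1
  refine (ENNReal.pow_right_strictMono two_ne_zero).injective ?_
  show _ ^ 2 = _ ^ 2
  rw [lintegral_enorm_mul_section_sub hg_meas hg hĝ, eLpNorm_mul_gammaRoot_sq hg_meas hg hĝ]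
  fun_prop

end Gamma

theorem eLpNorm_two_sq_eq_ofReal_integral {α : Type*} [MeasurableSpace α] {μ : Measure α}
    {f : α → ℝ} (hf : MemLp f 2 μ) : eLpNorm f 2 μ ^ 2 = ENNReal.ofReal (∫ x, f x ^ 2 ∂μ) := by
  rw [eLpNorm_two_sq, ofReal_integral_eq_lintegral_ofReal hf.integrable_sq
    (Eventually.of_forall fun x => by positivity)]
  refine lintegral_congr fun x => ?_
  rw [← ofReal_norm, ← ENNReal.ofReal_pow (norm_nonneg _), Real.norm_eq_abs, sq_abs]

/-! ### Gaussian bases -/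

section Basis

variable {Ω S : Type*} [mΩ : MeasurableSpace Ω] [MeasurableSpace S]
  {P : Measure Ω} {c : Measure S} {W : Set S → Ω → ℝ}

namespace IsGaussianBasis

section

variable (hW : IsGaussianBasis P c W) {A A' : Set S} (hA : MeasurableSet A) (hcA : c A < ∞)
  (hA' : MeasurableSet A') (hcA' : c A' < ∞)

include hW hA hcA

theorem memLp : MemLp (W A) 2 P := by
  have hm := hW.measurable A hA hcA
  have h := memLp_id_gaussianReal (μ := 0) (v := (c A).toNNReal) 2
  rw [← hW.law A hA hcA] at h
  exact (memLp_map_measure_iff aestronglyMeasurable_id hm.aemeasurable).1 h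

theorem integral_eq_zero : ∫ ω, W A ω ∂P = 0 := by
  have hm := hW.measurable A hA hcA
  have := integral_map (μ := P) hm.aemeasurable (f := fun x : ℝ => x)
    measurable_id.aestronglyMeasurable
  rw [← this, hW.law A hA hcA, integral_id_gaussianReal]

theorem integral_sq : ∫ ω, W A ω * W A ω ∂P = c.real A := by
  have hm := hW.measurable A hA hcA
  have h1 := variance_id_gaussianReal (μ := 0) (v := (c A).toNNReal)
  rw [← hW.law A hA hcA, variance_map aemeasurable_id hm.aemeasurable, Function.id_comp,
    variance_of_integral_eq_zero hm.aemeasurable (hW.integral_eq_zero hA hcA)] at h1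
  rw [ENNReal.coe_toNNReal_eq_toReal] at h1
  simpa only [sq, Measure.real] using h1

include hA' hcA'

theorem integral_mul_of_disjoint (hd : Disjoint A A') : ∫ ω, W A ω * W A' ω ∂P = 0 := by
  -- Independence is given for sequences of sets, so the pair is padded with empty sets.
  let D : ℕ → Set S := fun n => if n = 0 then A else if n = 1 then A' else ∅
  have hD : Pairwise (Function.onFun Disjoint D) := by
    intro i j hij
    simp only [Function.onFun, D]
    split_ifs <;> simp_all [disjoint_comm]
  have hi := hW.indep D (fun n => by simp only [D]; split_ifs <;> simp [*])
    (fun n => by simp only [D]; split_ifs <;> simp [*]) hD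
  have h01 : IndepFun (W A) (W A') P := hi.indepFun (i := 0) (j := 1) (by norm_num)
  rw [h01.integral_fun_mul_eq_mul_integral (hW.measurable A hA hcA).aestronglyMeasurable
    (hW.measurable A' hA' hcA').aestronglyMeasurable, hW.integral_eq_zero hA hcA, zero_mul]

omit hA hcA hA' hcA' in
theorem empty_ae_eq_zero : W ∅ =ᵐ[P] 0 := by
  have hm := hW.measurable ∅ MeasurableSet.empty (by simp)
  have h := hW.law ∅ MeasurableSet.empty (by simp)
  rw [measure_empty, ENNReal.toNNReal_zero, gaussianReal_zero_var] at h
  have h2 : ∀ᵐ x ∂(P.map (W ∅)), x = 0 := by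
    rw [h]
    exact (ae_dirac_iff (measurableSet_singleton (0 : ℝ))).2 rfl
  exact ae_of_ae_map hm.aemeasurable h2

theorem union_ae_eq (hd : Disjoint A A') : W (A ∪ A') =ᵐ[P] W A + W A' := by
  let D : ℕ → Set S := fun n => if n = 0 then A else if n = 1 then A' else ∅
  have hD : Pairwise (Function.onFun Disjoint D) := by
    intro i j hij
    simp only [Function.onFun, D]
    split_ifs <;> simp_all [disjoint_comm]
  have hU : ⋃ n, D n = A ∪ A' := by
    apply subset_antisymm
    · refine Set.iUnion_subset fun n => ?_
      simp only [D]
      split_ifs <;> simp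
    · exact Set.union_subset (Set.subset_iUnion D 0) (Set.subset_iUnion D 1)
  have hadd := hW.additive D (fun n => by simp only [D]; split_ifs <;> simp [*])
    (by rw [hU]; exact (measure_union_le _ _).trans_lt (ENNReal.add_lt_top.2 ⟨hcA, hcA'⟩)) hD
  rw [hU] at hadd
  filter_upwards [hadd, hW.empty_ae_eq_zero] with ω h1 h2
  -- From N = 2 on, the partial sums are constant outside the null set where W ∅ fails to vanish.
  refine tendsto_nhds_unique h1 (tendsto_const_nhds.congr' ?_)
  filter_upwards [eventually_ge_atTop 2] with N hN
  obtain ⟨k, rfl⟩ := Nat.exists_eq_add_of_le hN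
  rw [Finset.sum_range_add, Finset.sum_range_succ, Finset.sum_range_one,
    Finset.sum_eq_zero (s := Finset.range k) (fun i _ => ?_)]
  · simp [D]
  · have : D (2 + i) = ∅ := by simp [D]; omega
    rw [this, h2, Pi.zero_apply]

/-- Split both sets along their intersection: products over disjoint pieces have mean zero by
independence, and only the second moment of W(A ∩ A') survives. -/
theorem integral_mul : ∫ ω, W A ω * W A' ω ∂P = c.real (A ∩ A') := by
  have hI := hA.inter hA'
  have hcI : c (A ∩ A') < ∞ := (measure_mono Set.inter_subset_left).trans_lt hcA
  have hL := hA.diff hA'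
  have hcL : c (A \ A') < ∞ := (measure_mono Set.sdiff_subset).trans_lt hcA
  have hR := hA'.diff hA
  have hcR : c (A' \ A) < ∞ := (measure_mono Set.sdiff_subset).trans_lt hcA'
  have d1 : Disjoint (A ∩ A') (A \ A') := Set.disjoint_sdiff_inter.symm
  have d2 : Disjoint (A ∩ A') (A' \ A) := by
    rw [Set.inter_comm]; exact Set.disjoint_sdiff_inter.symm
  have d3 : Disjoint (A \ A') (A' \ A) := disjoint_sdiff_sdiff
  have e1 := hW.union_ae_eq hI hcI hL hcL d1
  have e2 := hW.union_ae_eq hI hcI hR hcR d2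
  rw [Set.inter_union_sdiff] at e1
  rw [Set.inter_comm, Set.inter_union_sdiff, Set.inter_comm] at e2
  have i1 := (hW.memLp hI hcI).integrable_mul (hW.memLp hI hcI)
  have i2 := (hW.memLp hI hcI).integrable_mul (hW.memLp hR hcR)
  have i3 := (hW.memLp hL hcL).integrable_mul (hW.memLp hI hcI)
  have i4 := (hW.memLp hL hcL).integrable_mul (hW.memLp hR hcR)
  have e3 : (fun ω => W A ω * W A' ω) =ᵐ[P] (W (A ∩ A') * W (A ∩ A') + W (A ∩ A') * W (A' \ A)) +
      (W (A \ A') * W (A ∩ A') + W (A \ A') * W (A' \ A)) := by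
    filter_upwards [e1, e2] with ω h1 h2
    rw [h1, h2]
    simp only [Pi.add_apply, Pi.mul_apply]
    ring
  rw [integral_congr_ae e3, integral_add' (i1.add i2) (i3.add i4), integral_add' i1 i2,
    integral_add' i3 i4]
  simp only [Pi.mul_apply]
  rw [hW.integral_sq hI hcI, hW.integral_mul_of_disjoint hI hcI hR hcR d2,
    hW.integral_mul_of_disjoint hL hcL hI hcI d1.symm,
    hW.integral_mul_of_disjoint hL hcL hR hcR d3]
  ring

end

end IsGaussianBasis

/-! ### Integrals of simple integrands -/

variable {τ : S → ℝ} {ℱ : Filtration ℝ mΩ}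

namespace ElementaryIntegrand

variable [IsProbabilityMeasure P]

variable (e e' : ElementaryIntegrand c τ ℱ)

theorem measurable' : Measurable e.ξ := e.measurable.mono (ℱ.le _) le_rfl

theorem integrable_mul : Integrable (fun ω => e.ξ ω * e'.ξ ω) P := by
  obtain ⟨C, hC⟩ := e.bounded
  obtain ⟨C', hC'⟩ := e'.bounded
  refine Integrable.of_bound (e.measurable'.mul e'.measurable').aestronglyMeasurable (C * C')
    (Eventually.of_forall fun ω => ?_)
  rw [norm_mul]
  exact mul_le_mul (hC ω) (hC' ω) (norm_nonneg _) ((abs_nonneg _).trans (hC ω))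

/-- The value of an elementary integrand. -/
noncomputable def value (z : S) (ω : Ω) : ℝ := e.ξ ω * e.A.indicator (fun _ => (1 : ℝ)) z

theorem measurable_value : Measurable fun q : S × Ω => e.value q.1 q.2 :=
  (e.measurable'.comp measurable_snd).mul
    ((measurable_const.indicator e.measurableSet).comp measurable_fst)

theorem memLp_value : MemLp (fun q : S × Ω => e.value q.1 q.2) 2 (c.prod P) := by
  refine (memLp_two_iff_integrable_sq e.measurable_value.aestronglyMeasurable).2 ?_
  have h1 : Integrable (e.A.indicator (fun _ => (1 : ℝ))) c :=
    (integrable_indicator_iff e.measurableSet).2 (integrableOn_const e.finite.ne)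
  refine (h1.mul_prod (e.integrable_mul e (P := P))).congr (Eventually.of_forall fun q => ?_)
  by_cases h : q.1 ∈ e.A <;> simp [value, h, sq]

theorem integral_value_mul [SFinite c] :
    ∫ q : S × Ω, e.value q.1 q.2 * e'.value q.1 q.2 ∂(c.prod P) =
      c.real (e.A ∩ e'.A) * ∫ ω, e.ξ ω * e'.ξ ω ∂P := by
  rw [← integral_indicator_one (e.measurableSet.inter e'.measurableSet), ← integral_prod_mul]
  congr 1
  funext q
  by_cases h : q.1 ∈ e.A <;> by_cases h' : q.1 ∈ e'.A <;> simp [value, h, h']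

end ElementaryIntegrand

omit mΩ in
theorem measurable_noiseAlgebra {R A : Set S} (hA : MeasurableSet A) (hcA : c A < ∞)
    (hAR : A ⊆ R) : Measurable[noiseAlgebra c W R] (W A) :=
  Measurable.of_comap_le (le_iSup₂_of_le A ⟨hA, hcA, hAR⟩ le_rfl)

/-- The martingale property in the form needed: what is known at time r decouples from any
functional of the noise after r. -/
theorem IsCompatible.integral_mul (hC : IsCompatible P c τ ℱ W) {r : ℝ} {ξ V : Ω → ℝ}
    (hξ : Measurable[ℱ r] ξ) (hV : Measurable[noiseAlgebra c W {z | r < τ z}] V)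
    (hV' : Measurable V) : ∫ ω, ξ ω * V ω ∂P = (∫ ω, ξ ω ∂P) * ∫ ω, V ω ∂P := by
  have hi : IndepFun ξ V P := by
    rw [IndepFun_iff_Indep]
    exact indep_of_indep_of_le_left (indep_of_indep_of_le_right (hC.future r).symm hV.comap_le)
      hξ.comap_le
  exact hi.integral_fun_mul_eq_mul_integral
    (hξ.mono (ℱ.le r) le_rfl).aestronglyMeasurable hV'.aestronglyMeasurable

section Simple

variable (hτ : Measurable τ) (hW : IsGaussianBasis P c W) (hC : IsCompatible P c τ ℱ W)

include hτ hW hC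

/-- The time strips may overlap, so e.A is cut at e'.a, the later of the two starting times. The
noise of the earlier piece is known at e'.a and W(e'.A) is centred and independent of it, so that
piece contributes 0. For the later piece both noises are independent of the two coefficients. -/
theorem ElementaryIntegrand.integral_mul_of_le (e e' : ElementaryIntegrand c τ ℱ)
    (hle : e.a ≤ e'.a) :
    ∫ ω, (e.ξ ω * W e.A ω) * (e'.ξ ω * W e'.A ω) ∂P =
      c.real (e.A ∩ e'.A) * ∫ ω, e.ξ ω * e'.ξ ω ∂P := by
  set A₁ := e.A ∩ {z | τ z ≤ e'.a} with hA₁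
  set A₂ := e.A ∩ {z | e'.a < τ z} with hA₂
  have hm₁ : MeasurableSet A₁ := e.measurableSet.inter (measurableSet_le hτ measurable_const)
  have hm₂ : MeasurableSet A₂ := e.measurableSet.inter (measurableSet_lt measurable_const hτ)
  have hc₁ : c A₁ < ∞ := (measure_mono Set.inter_subset_left).trans_lt e.finite
  have hc₂ : c A₂ < ∞ := (measure_mono Set.inter_subset_left).trans_lt e.finite
  have hd : Disjoint A₁ A₂ := Set.disjoint_left.2 fun z h h' => absurd (show τ z ≤ e'.a from h.2) (not_le.2 h'.2)
  have hU : A₁ ∪ A₂ = e.A := by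
    rw [hA₁, hA₂, ← Set.inter_union_distrib_left]
    refine Set.inter_eq_left.2 fun z _ => (le_or_gt (τ z) e'.a : _ ∨ _)
  have hadd := hW.union_ae_eq hm₁ hc₁ hm₂ hc₂ hd
  rw [hU] at hadd
  have hξ : Measurable[ℱ e'.a] e.ξ := e.measurable.mono (ℱ.mono hle) le_rfl
  have hW₁ : Measurable[ℱ e'.a] (W A₁) :=
    (measurable_noiseAlgebra hm₁ hc₁ Set.inter_subset_right).mono (hC.adapted e'.a) le_rfl
  have hW₂ : Measurable[noiseAlgebra c W {z | e'.a < τ z}] (W A₂) :=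
    measurable_noiseAlgebra hm₂ hc₂ Set.inter_subset_right
  have hW' : Measurable[noiseAlgebra c W {z | e'.a < τ z}] (W e'.A) :=
    measurable_noiseAlgebra e'.measurableSet e'.finite fun z hz => (e'.strip z hz).1
  have hmW' := hW.measurable e'.A e'.measurableSet e'.finite
  have hmW₂ := hW.measurable A₂ hm₂ hc₂
  have f1 : ∫ ω, (e.ξ ω * e'.ξ ω * W A₁ ω) * W e'.A ω ∂P = 0 := by
    rw [hC.integral_mul (ξ := fun ω => e.ξ ω * e'.ξ ω * W A₁ ω) ((hξ.mul e'.measurable).mul hW₁)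
      hW' hmW',
      hW.integral_eq_zero e'.measurableSet e'.finite, mul_zero]
  have f2 : ∫ ω, (e.ξ ω * e'.ξ ω) * (W A₂ ω * W e'.A ω) ∂P =
      (∫ ω, e.ξ ω * e'.ξ ω ∂P) * c.real (A₂ ∩ e'.A) := by
    rw [hC.integral_mul (ξ := fun ω => e.ξ ω * e'.ξ ω) (V := fun ω => W A₂ ω * W e'.A ω)
      (hξ.mul e'.measurable) (hW₂.mul hW') (hmW₂.mul hmW'),
      hW.integral_mul hm₂ hc₂ e'.measurableSet e'.finite]
  have hint : ∀ {A : Set S}, MeasurableSet A → c A < ∞ →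
      Integrable (fun ω => (e.ξ ω * e'.ξ ω) * (W A ω * W e'.A ω)) P := by
    intro A hA hcA
    obtain ⟨C, hC⟩ := e.bounded
    obtain ⟨C', hC'⟩ := e'.bounded
    refine Integrable.bdd_mul (c := C * C')
      ((hW.memLp hA hcA).integrable_mul (hW.memLp e'.measurableSet e'.finite))
      (e.measurable'.mul e'.measurable').aestronglyMeasurable (Eventually.of_forall fun ω => ?_)
    rw [norm_mul]
    exact mul_le_mul (hC ω) (hC' ω) (norm_nonneg _) ((abs_nonneg _).trans (hC ω))
  -- Nothing is lost by the cut, because e'.A lies strictly after e'.a.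
  have hI : A₂ ∩ e'.A = e.A ∩ e'.A := by
    ext z
    constructor
    · exact fun h => ⟨h.1.1, h.2⟩
    · exact fun h => ⟨⟨h.1, (e'.strip z h.2).1⟩, h.2⟩
  calc ∫ ω, (e.ξ ω * W e.A ω) * (e'.ξ ω * W e'.A ω) ∂P
      = ∫ ω, ((e.ξ ω * e'.ξ ω) * (W A₁ ω * W e'.A ω) +
          (e.ξ ω * e'.ξ ω) * (W A₂ ω * W e'.A ω)) ∂P := by
        refine integral_congr_ae ?_
        filter_upwards [hadd] with ω h
        rw [h, Pi.add_apply]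
        ring
    _ = c.real (e.A ∩ e'.A) * ∫ ω, e.ξ ω * e'.ξ ω ∂P := by
        rw [integral_add (hint hm₁ hc₁) (hint hm₂ hc₂), f2, hI]
        simp only [← mul_assoc] at f1 ⊢
        rw [f1, zero_add, mul_comm]

theorem ElementaryIntegrand.integral_mul (e e' : ElementaryIntegrand c τ ℱ) :
    ∫ ω, (e.ξ ω * W e.A ω) * (e'.ξ ω * W e'.A ω) ∂P =
      c.real (e.A ∩ e'.A) * ∫ ω, e.ξ ω * e'.ξ ω ∂P := by
  rcases le_total e.a e'.a with h | h
  · exact e.integral_mul_of_le hτ hW hC e' h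
  · have := e'.integral_mul_of_le hτ hW hC e h
    rw [Set.inter_comm] at this
    simpa only [mul_comm] using this

omit hτ hC in
theorem ElementaryIntegrand.memLp_integral (e : ElementaryIntegrand c τ ℱ) :
    MemLp (fun ω => e.ξ ω * W e.A ω) 2 P := by
  obtain ⟨C, hC⟩ := e.bounded
  refine (hW.memLp e.measurableSet e.finite).of_le_mul (c := C)
    (e.measurable'.mul (hW.measurable _ e.measurableSet e.finite)).aestronglyMeasurable
    (Eventually.of_forall fun ω => ?_)
  rw [norm_mul]
  exact mul_le_mul_of_nonneg_right (hC ω) (norm_nonneg _)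

omit hτ in
theorem ElementaryIntegrand.integral_eq_zero (e : ElementaryIntegrand c τ ℱ) :
    ∫ ω, e.ξ ω * W e.A ω ∂P = 0 := by
  rw [hC.integral_mul e.measurable (measurable_noiseAlgebra e.measurableSet e.finite
    fun z hz => (e.strip z hz).1) (hW.measurable _ e.measurableSet e.finite),
    hW.integral_eq_zero e.measurableSet e.finite, mul_zero]

end Simple

end Basis

theorem integrable_mul_of_memLp_two {α : Type*} [MeasurableSpace α] {μ : Measure α} {f h : α → ℝ}
    (hf : MemLp f 2 μ) (hh : MemLp h 2 μ) : Integrable (fun x => f x * h x) μ :=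
  hf.integrable_mul hh

/-! ### Linear operations on simple integrands and the isometry for them -/

section StochasticIntegral

variable {Ω S : Type*} [mΩ : MeasurableSpace Ω] [MeasurableSpace S]
  {P : Measure Ω} {c : Measure S} {τ : S → ℝ} {ℱ : Filtration ℝ mΩ} {W : Set S → Ω → ℝ}

/-- A multiple of an elementary integrand. -/
def ElementaryIntegrand.smul (r : ℝ) (e : ElementaryIntegrand c τ ℱ) :
    ElementaryIntegrand c τ ℱ :=
  { e with
    ξ := fun ω => r * e.ξ ω
    measurable := e.measurable.const_mul r
    bounded := by
      obtain ⟨C, hC⟩ := e.bounded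
      refine ⟨|r| * C, fun ω => ?_⟩
      rw [abs_mul]
      exact mul_le_mul_of_nonneg_left (hC ω) (abs_nonneg r) }

section Algebra

variable (e : ElementaryIntegrand c τ ℱ) (l l' : List (ElementaryIntegrand c τ ℱ)) (r : ℝ)

theorem simpleValue_cons (z : S) (ω : Ω) :
    simpleValue (e :: l) z ω = e.value z ω + simpleValue l z ω := by
  simp [simpleValue, ElementaryIntegrand.value]

theorem simpleIntegral_cons (ω : Ω) :
    simpleIntegral W (e :: l) ω = e.ξ ω * W e.A ω + simpleIntegral W l ω := by
  simp [simpleIntegral]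

theorem simpleValue_append (z : S) (ω : Ω) :
    simpleValue (l ++ l') z ω = simpleValue l z ω + simpleValue l' z ω := by
  simp [simpleValue]

theorem simpleIntegral_append (ω : Ω) :
    simpleIntegral W (l ++ l') ω = simpleIntegral W l ω + simpleIntegral W l' ω := by
  simp [simpleIntegral]

theorem simpleValue_smul (z : S) (ω : Ω) :
    simpleValue (l.map (·.smul r)) z ω = r * simpleValue l z ω := by
  induction l with
  | nil => simp [simpleValue]
  | cons e l ih =>
    rw [List.map_cons, simpleValue_cons, simpleValue_cons, ih, mul_add]
    simp [ElementaryIntegrand.value, ElementaryIntegrand.smul, mul_assoc]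

theorem simpleIntegral_smul (ω : Ω) :
    simpleIntegral W (l.map (·.smul r)) ω = r * simpleIntegral W l ω := by
  induction l with
  | nil => simp [simpleIntegral]
  | cons e l ih =>
    rw [List.map_cons, simpleIntegral_cons, simpleIntegral_cons, ih, mul_add]
    simp [ElementaryIntegrand.smul, mul_assoc]

end Algebra

variable [IsProbabilityMeasure P]

theorem memLp_simpleValue (l : List (ElementaryIntegrand c τ ℱ)) :
    MemLp (fun q : S × Ω => simpleValue l q.1 q.2) 2 (c.prod P) := by
  induction l with
  | nil => simp [simpleValue]
  | cons e l ih =>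
    simp only [simpleValue_cons]
    exact e.memLp_value.add ih

omit [IsProbabilityMeasure P] in
theorem memLp_simpleIntegral (hW : IsGaussianBasis P c W) (l : List (ElementaryIntegrand c τ ℱ)) :
    MemLp (simpleIntegral W l) 2 P := by
  induction l with
  | nil => exact (MemLp.zero : MemLp (fun _ : Ω => (0 : ℝ)) 2 P)
  | cons e l ih =>
    have : simpleIntegral W (e :: l) = fun ω => e.ξ ω * W e.A ω + simpleIntegral W l ω :=
      funext (simpleIntegral_cons e l)
    rw [this]
    exact (e.memLp_integral hW).add ih

section Isometry

variable (hτ : Measurable τ) (hW : IsGaussianBasis P c W) (hC : IsCompatible P c τ ℱ W)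

include hW hC

theorem integral_simpleIntegral (l : List (ElementaryIntegrand c τ ℱ)) :
    ∫ ω, simpleIntegral W l ω ∂P = 0 := by
  induction l with
  | nil => simp [simpleIntegral]
  | cons e l ih =>
    simp only [simpleIntegral_cons]
    rw [integral_add ((e.memLp_integral hW).integrable one_le_two)
      ((memLp_simpleIntegral hW l).integrable one_le_two), ih, e.integral_eq_zero hW hC, add_zero]

include hτ

variable [SFinite c]

/-- Both sides are bilinear, so an induction over each list reduces to two elementary integrands.
Allowing arbitrary lists means no common refinement of the sets is required. -/
theorem integral_simpleIntegral_mul (l l' : List (ElementaryIntegrand c τ ℱ)) :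
    ∫ ω, simpleIntegral W l ω * simpleIntegral W l' ω ∂P =
      ∫ q : S × Ω, simpleValue l q.1 q.2 * simpleValue l' q.1 q.2 ∂(c.prod P) := by
  induction l with
  | nil => simp [simpleIntegral, simpleValue]
  | cons e l ih =>
    have h1 : ∫ ω, (e.ξ ω * W e.A ω) * simpleIntegral W l' ω ∂P =
        ∫ q : S × Ω, e.value q.1 q.2 * simpleValue l' q.1 q.2 ∂(c.prod P) := by
      clear ih
      induction l' with
      | nil => simp [simpleIntegral, simpleValue]
      | cons e' l' ih =>
        simp only [simpleIntegral_cons, simpleValue_cons, mul_add]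
        rw [integral_add (integrable_mul_of_memLp_two (e.memLp_integral hW) (e'.memLp_integral hW))
          (integrable_mul_of_memLp_two (e.memLp_integral hW) (memLp_simpleIntegral hW l')),
          integral_add (integrable_mul_of_memLp_two e.memLp_value e'.memLp_value)
          (integrable_mul_of_memLp_two e.memLp_value (memLp_simpleValue l')), ih,
          e.integral_mul hτ hW hC e', e.integral_value_mul e']
    simp only [simpleIntegral_cons, simpleValue_cons, add_mul]
    rw [integral_add (integrable_mul_of_memLp_two (e.memLp_integral hW) (memLp_simpleIntegral hW l'))
      (integrable_mul_of_memLp_two (memLp_simpleIntegral hW l) (memLp_simpleIntegral hW l')),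
      integral_add (integrable_mul_of_memLp_two e.memLp_value (memLp_simpleValue l'))
      (integrable_mul_of_memLp_two (memLp_simpleValue l) (memLp_simpleValue l')), h1, ih]

theorem eLpNorm_simpleIntegral (l : List (ElementaryIntegrand c τ ℱ)) :
    eLpNorm (simpleIntegral W l) 2 P =
      eLpNorm (fun q : S × Ω => simpleValue l q.1 q.2) 2 (c.prod P) := by
  refine (ENNReal.pow_right_strictMono two_ne_zero).injective ?_
  show _ ^ 2 = _ ^ 2
  rw [eLpNorm_two_sq_eq_ofReal_integral (memLp_simpleIntegral hW l),
    eLpNorm_two_sq_eq_ofReal_integral (memLp_simpleValue l)]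
  simp only [sq]
  rw [integral_simpleIntegral_mul hτ hW hC]

theorem eLpNorm_simpleIntegral_sub (l l' : List (ElementaryIntegrand c τ ℱ)) :
    eLpNorm (fun ω => simpleIntegral W l ω - simpleIntegral W l' ω) 2 P =
      eLpNorm (fun q : S × Ω => simpleValue l q.1 q.2 - simpleValue l' q.1 q.2) 2
        (c.prod P) := by
  -- The difference is itself a simple integrand: concatenation with the negated list.
  have := eLpNorm_simpleIntegral hτ hW hC (l ++ l'.map (·.smul (-1)))
  simp only [simpleValue_append, simpleValue_smul] at this
  rw [funext (simpleIntegral_append l (l'.map (·.smul (-1))))] at this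
  simpa only [simpleIntegral_smul, neg_one_mul, ← sub_eq_add_neg] using this

end Isometry

/-! ### The stochastic integral -/

namespace IsStochIntegral

variable {φ φ' : S → Ω → ℝ} {Y Y' : Ω → ℝ}

omit [IsProbabilityMeasure P] in
theorem congr_ae (h : IsStochIntegral P c τ ℱ W φ Y)
    (hφ : (fun q : S × Ω => φ q.1 q.2) =ᵐ[c.prod P] fun q => φ' q.1 q.2) :
    IsStochIntegral P c τ ℱ W φ' Y := by
  obtain ⟨hY, l, h1, h2⟩ := h
  refine ⟨hY, l, h1.congr fun n => eLpNorm_congr_ae ?_, h2⟩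
  filter_upwards [hφ] with q hq
  rw [hq]

theorem add (hW : IsGaussianBasis P c W)
    (hφ : AEStronglyMeasurable (fun q : S × Ω => φ q.1 q.2) (c.prod P))
    (hφ' : AEStronglyMeasurable (fun q : S × Ω => φ' q.1 q.2) (c.prod P))
    (h : IsStochIntegral P c τ ℱ W φ Y) (h' : IsStochIntegral P c τ ℱ W φ' Y') :
    IsStochIntegral P c τ ℱ W (fun z ω => φ z ω + φ' z ω) (fun ω => Y ω + Y' ω) := by
  obtain ⟨hY, l, h1, h2⟩ := h
  obtain ⟨hY', l', h1', h2'⟩ := h'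
  refine ⟨hY.add hY', fun n => l n ++ l' n, ?_, ?_⟩
  · refine tendsto_of_tendsto_of_tendsto_of_le_of_le tendsto_const_nhds
      (by simpa using h1.add h1') (fun n => zero_le) fun n => ?_
    refine le_trans (le_of_eq ?_) (eLpNorm_add_le ((memLp_simpleValue (l n)).1.sub hφ)
      ((memLp_simpleValue (l' n)).1.sub hφ') one_le_two)
    congr 1
    funext q
    simp only [simpleValue_append, Pi.add_apply]
    ring
  · refine tendsto_of_tendsto_of_tendsto_of_le_of_le tendsto_const_nhds
      (by simpa using h2.add h2') (fun n => zero_le) fun n => ?_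
    refine le_trans (le_of_eq ?_) (eLpNorm_add_le ((memLp_simpleIntegral hW (l n)).1.sub hY.1)
      ((memLp_simpleIntegral hW (l' n)).1.sub hY'.1) one_le_two)
    congr 1
    funext ω
    simp only [simpleIntegral_append, Pi.add_apply]
    ring

omit [IsProbabilityMeasure P] in
theorem const_mul (r : ℝ) (h : IsStochIntegral P c τ ℱ W φ Y) :
    IsStochIntegral P c τ ℱ W (fun z ω => r * φ z ω) (fun ω => r * Y ω) := by
  obtain ⟨hY, l, h1, h2⟩ := h
  refine ⟨hY.const_mul r, fun n => (l n).map (·.smul r), ?_, ?_⟩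
  · have := ENNReal.Tendsto.const_mul (a := ‖r‖ₑ) h1 (Or.inr enorm_ne_top)
    rw [mul_zero] at this
    refine this.congr fun n => ?_
    rw [← eLpNorm_const_smul]
    congr 1
    funext q
    simp only [simpleValue_smul, Pi.smul_apply, smul_eq_mul, mul_sub]
  · have := ENNReal.Tendsto.const_mul (a := ‖r‖ₑ) h2 (Or.inr enorm_ne_top)
    rw [mul_zero] at this
    refine this.congr fun n => ?_
    rw [← eLpNorm_const_smul]
    congr 1
    funext q
    simp only [simpleIntegral_smul, Pi.smul_apply, smul_eq_mul, mul_sub]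

theorem sub (hW : IsGaussianBasis P c W)
    (hφ : AEStronglyMeasurable (fun q : S × Ω => φ q.1 q.2) (c.prod P))
    (hφ' : AEStronglyMeasurable (fun q : S × Ω => φ' q.1 q.2) (c.prod P))
    (h : IsStochIntegral P c τ ℱ W φ Y) (h' : IsStochIntegral P c τ ℱ W φ' Y') :
    IsStochIntegral P c τ ℱ W (fun z ω => φ z ω - φ' z ω) (fun ω => Y ω - Y' ω) := by
  simpa only [neg_one_mul, ← sub_eq_add_neg] using
    h.add hW hφ (hφ'.const_mul (-1)) (h'.const_mul (-1))

/-- The Itô isometry. -/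
theorem eLpNorm_eq [SFinite c] (hτ : Measurable τ) (hW : IsGaussianBasis P c W)
    (hC : IsCompatible P c τ ℱ W)
    (hφ : AEStronglyMeasurable (fun q : S × Ω => φ q.1 q.2) (c.prod P))
    (h : IsStochIntegral P c τ ℱ W φ Y) :
    eLpNorm Y 2 P = eLpNorm (fun q : S × Ω => φ q.1 q.2) 2 (c.prod P) := by
  obtain ⟨hY, l, h1, h2⟩ := h
  have h3 : Tendsto (fun n => eLpNorm (fun q : S × Ω => simpleValue (l n) q.1 q.2 - φ q.1 q.2) 2
      (c.prod P) + eLpNorm (fun ω => simpleIntegral W (l n) ω - Y ω) 2 P) atTop (𝓝 0) := by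
    simpa using h1.add h2
  have hVφ := fun n => eLpNorm_sub_comm (fun q : S × Ω => simpleValue (l n) q.1 q.2)
    (fun q => φ q.1 q.2) 2 (c.prod P)
  have hIY := fun n => eLpNorm_sub_comm (simpleIntegral W (l n)) Y 2 P
  have isom := fun n => eLpNorm_simpleIntegral hτ hW hC (l n)
  have hV := fun n => (memLp_simpleValue (P := P) (l n)).1
  have hI := fun n => (memLp_simpleIntegral hW (l n)).1
  -- Each inequality goes through the approximations: Y is close to the simple integral, which has
  -- the norm of the simple integrand, which is close to φ. The total error is the sequence in `h3`.
  refine le_antisymm ?_ ?_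
  · refine ge_of_tendsto' (by simpa using h3.const_add _) fun n => ?_
    have a1 := eLpNorm_add_le (hY.1.sub (hI n)) (hI n) one_le_two
    have a2 := eLpNorm_add_le ((hV n).sub hφ) hφ one_le_two
    rw [sub_add_cancel] at a1 a2
    rw [isom, ← hIY] at a1
    refine a1.trans ((add_le_add_right a2 _).trans (le_of_eq ?_))
    simp only [Pi.sub_def]
    ring
  · refine ge_of_tendsto' (by simpa using h3.const_add _) fun n => ?_
    have a1 := eLpNorm_add_le (hφ.sub (hV n)) (hV n) one_le_two
    have a2 := eLpNorm_add_le ((hI n).sub hY.1) hY.1 one_le_two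
    rw [sub_add_cancel] at a1 a2
    rw [← isom, ← hVφ] at a1
    refine a1.trans ((add_le_add_right a2 _).trans (le_of_eq ?_))
    simp only [Pi.sub_def]
    ring

theorem integral_eq_zero (hW : IsGaussianBasis P c W) (hC : IsCompatible P c τ ℱ W)
    (h : IsStochIntegral P c τ ℱ W φ Y) : ∫ ω, Y ω ∂P = 0 := by
  obtain ⟨hY, l, h1, h2⟩ := h
  have h3 : Tendsto (fun n => eLpNorm (simpleIntegral W (l n) - Y) 1 P) atTop (𝓝 0) :=
    tendsto_of_tendsto_of_tendsto_of_le_of_le tendsto_const_nhds h2 (fun n => zero_le) fun n =>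
      eLpNorm_le_eLpNorm_of_exponent_le one_le_two
        ((memLp_simpleIntegral hW (l n)).1.sub hY.1)
  have h4 := tendsto_integral_of_L1' Y hY.1 (F := fun n => simpleIntegral W (l n))
    (Eventually.of_forall fun n => (memLp_simpleIntegral hW (l n)).integrable one_le_two) h3
  simp only [integral_simpleIntegral hW hC] at h4
  exact tendsto_nhds_unique h4 tendsto_const_nhds |>.symm ▸ rfl

end IsStochIntegral

/-- `φ` is an `L²`-limit of simple integrands. -/
def IsSimpleLimit (P : Measure Ω) (c : Measure S) (τ : S → ℝ) (ℱ : Filtration ℝ mΩ)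
    (φ : S × Ω → ℝ) : Prop :=
  ∀ ε : ℝ≥0∞, ε ≠ 0 → ∃ l : List (ElementaryIntegrand c τ ℱ),
    eLpNorm ((fun q : S × Ω => simpleValue l q.1 q.2) - φ) 2 (c.prod P) ≤ ε

/-- The isometry on differences carries a Cauchy sequence of simple integrands to a Cauchy sequence
in L²(P); its limit is the integral. -/
theorem IsSimpleLimit.exists_isStochIntegral [SFinite c] (hτ : Measurable τ)
    (hW : IsGaussianBasis P c W) (hC : IsCompatible P c τ ℱ W) {φ : S → Ω → ℝ}
    (hφ : MemLp (fun q : S × Ω => φ q.1 q.2) 2 (c.prod P))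
    (h : IsSimpleLimit P c τ ℱ fun q => φ q.1 q.2) :
    ∃ Y, IsStochIntegral P c τ ℱ W φ Y := by
  have hex : ∀ n : ℕ, ∃ l : List (ElementaryIntegrand c τ ℱ),
      eLpNorm ((fun q : S × Ω => simpleValue l q.1 q.2) - fun q => φ q.1 q.2) 2 (c.prod P) ≤
        ((n : ℝ≥0∞) + 1)⁻¹ := fun n => h _ (by simp)
  choose l hl using hex
  have hlim : Tendsto (fun n : ℕ => ((n : ℝ≥0∞) + 1)⁻¹) atTop (𝓝 0) := by
    have := (tendsto_add_atTop_iff_nat 1).2 ENNReal.tendsto_inv_nat_nhds_zero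
    simpa using this
  have h1 : Tendsto (fun n => eLpNorm ((fun q : S × Ω => simpleValue (l n) q.1 q.2) -
      fun q => φ q.1 q.2) 2 (c.prod P)) atTop (𝓝 0) :=
    tendsto_of_tendsto_of_tendsto_of_le_of_le tendsto_const_nhds hlim (fun n => zero_le) hl
  have hV := fun n => memLp_simpleValue (P := P) (l n)
  have hI := fun n => memLp_simpleIntegral hW (l n)
  have h2 : Tendsto (fun n => (hV n).toLp) atTop (𝓝 hφ.toLp) :=
    (Lp.tendsto_Lp_iff_tendsto_eLpNorm'' _ hV _ hφ).2 h1
  have h3 : CauchySeq fun n => (hI n).toLp := by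
    rw [EMetric.cauchySeq_iff]
    intro ε hε
    obtain ⟨N, hN⟩ := EMetric.cauchySeq_iff.1 h2.cauchySeq ε hε
    refine ⟨N, fun m hm n hn => ?_⟩
    have := hN m hm n hn
    rw [Lp.edist_toLp_toLp] at this ⊢
    exact (eLpNorm_simpleIntegral_sub hτ hW hC (l m) (l n)).trans_lt this
  obtain ⟨Y, hY⟩ := cauchySeq_tendsto_of_complete h3
  refine ⟨Y, Lp.memLp Y, l, h1, ?_⟩
  have h4 := (Lp.tendsto_Lp_iff_tendsto_eLpNorm' _ _).1 hY
  refine h4.congr fun n => eLpNorm_congr_ae ?_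
  filter_upwards [(hI n).coeFn_toLp] with ω hω
  rw [Pi.sub_apply, hω]

omit [IsProbabilityMeasure P] in
theorem isStochIntegral_stochIntegral {φ : S → Ω → ℝ} (h : ∃ Y, IsStochIntegral P c τ ℱ W φ Y) :
    IsStochIntegral P c τ ℱ W φ (stochIntegral P c τ ℱ W φ) := by
  rw [stochIntegral, dif_pos h]
  exact h.choose_spec

end StochasticIntegral

/-! ### Predictable integrands are limits of simple ones -/

section Density

variable {Ω S : Type*} [mΩ : MeasurableSpace Ω] [MeasurableSpace S]
  {P : Measure Ω} {c : Measure S} {τ : S → ℝ} {ℱ : Filtration ℝ mΩ}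

namespace IsSimpleLimit

variable {φ φ' : S × Ω → ℝ}

theorem congr_ae (h : IsSimpleLimit P c τ ℱ φ) (hφ : φ =ᵐ[c.prod P] φ') :
    IsSimpleLimit P c τ ℱ φ' := fun ε hε => by
  obtain ⟨l, hl⟩ := h ε hε
  refine ⟨l, (eLpNorm_congr_ae ?_).trans_le hl⟩
  filter_upwards [hφ] with q hq
  simp only [Pi.sub_apply, hq]

theorem const_mul (r : ℝ) (h : IsSimpleLimit P c τ ℱ φ) :
    IsSimpleLimit P c τ ℱ fun q => r * φ q := fun ε hε => by
  rcases eq_or_ne r 0 with rfl | hr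
  · exact ⟨[], by simp [simpleValue]⟩
  have hr' : ‖r‖ₑ ≠ 0 := by simpa using hr
  obtain ⟨l, hl⟩ := h (‖r‖ₑ⁻¹ * ε) (mul_ne_zero (by simp) hε)
  refine ⟨l.map (·.smul r), ?_⟩
  have e : ((fun q : S × Ω => simpleValue (l.map (·.smul r)) q.1 q.2) - fun q => r * φ q) =
      r • ((fun q : S × Ω => simpleValue l q.1 q.2) - φ) := by
    funext q
    simp only [simpleValue_smul, Pi.sub_apply, Pi.smul_apply, smul_eq_mul, mul_sub]
  rw [e, eLpNorm_const_smul]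
  refine (mul_le_mul_right hl _).trans ?_
  rw [← mul_assoc, ENNReal.mul_inv_cancel hr' enorm_ne_top, one_mul]

variable [IsProbabilityMeasure P]

theorem add (hφ : AEStronglyMeasurable φ (c.prod P)) (hφ' : AEStronglyMeasurable φ' (c.prod P))
    (h : IsSimpleLimit P c τ ℱ φ) (h' : IsSimpleLimit P c τ ℱ φ') :
    IsSimpleLimit P c τ ℱ fun q => φ q + φ' q := fun ε hε => by
  obtain ⟨l, hl⟩ := h (ε / 2) (by simpa using hε)
  obtain ⟨l', hl'⟩ := h' (ε / 2) (by simpa using hε)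
  refine ⟨l ++ l', ?_⟩
  have e : ((fun q : S × Ω => simpleValue (l ++ l') q.1 q.2) - fun q => φ q + φ' q) =
      ((fun q : S × Ω => simpleValue l q.1 q.2) - φ) +
        ((fun q : S × Ω => simpleValue l' q.1 q.2) - φ') := by
    funext q
    simp only [simpleValue_append, Pi.sub_apply, Pi.add_apply]
    ring
  rw [e]
  refine (eLpNorm_add_le ((memLp_simpleValue l).1.sub hφ) ((memLp_simpleValue l').1.sub hφ')
    one_le_two).trans ((add_le_add hl hl').trans (ENNReal.add_halves ε).le)

theorem of_forall_exists (hφ : AEStronglyMeasurable φ (c.prod P))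
    (h : ∀ ε : ℝ≥0∞, ε ≠ 0 → ∃ ψ, AEStronglyMeasurable ψ (c.prod P) ∧
      IsSimpleLimit P c τ ℱ ψ ∧ eLpNorm (ψ - φ) 2 (c.prod P) ≤ ε) :
    IsSimpleLimit P c τ ℱ φ := fun ε hε => by
  obtain ⟨ψ, hψm, hψ, hψφ⟩ := h (ε / 2) (by simpa using hε)
  obtain ⟨l, hl⟩ := hψ (ε / 2) (by simpa using hε)
  refine ⟨l, ?_⟩
  rw [← sub_add_sub_cancel _ ψ φ]
  exact (eLpNorm_add_le ((memLp_simpleValue l).1.sub hψm) (hψm.sub hφ) one_le_two).trans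
    ((add_le_add hl hψφ).trans (ENNReal.add_halves ε).le)

/-- As the union has finite measure, the measure of what t n misses tends to 0, and with it the L²
norm of its indicator. This is the limit step of the π-λ argument. -/
theorem indicator_iUnion {t : ℕ → Set (S × Ω)} (ht : Monotone t)
    (htm : ∀ n, MeasurableSet (t n)) (hfin : (c.prod P) (⋃ n, t n) < ∞)
    (h : ∀ n, IsSimpleLimit P c τ ℱ ((t n).indicator fun _ => 1)) :
    IsSimpleLimit P c τ ℱ ((⋃ n, t n).indicator fun _ => 1) := by
  have hUm : MeasurableSet (⋃ n, t n) := MeasurableSet.iUnion htm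
  refine of_forall_exists (measurable_const.indicator hUm).aestronglyMeasurable fun ε hε => ?_
  obtain ⟨η, hη, hηε⟩ := exists_eLpNorm_indicator_le (μ := c.prod P) (p := 2) (by norm_num)
    (1 : ℝ) hε
  have hlim : Tendsto (fun n => (c.prod P) ((⋃ n, t n) \ t n)) atTop (𝓝 0) := by
    have h1 := tendsto_measure_iUnion_atTop (μ := c.prod P) ht
    have h2 := ENNReal.Tendsto.sub (tendsto_const_nhds (x := (c.prod P) (⋃ n, t n))) h1
      (Or.inl hfin.ne)
    rw [tsub_self] at h2
    refine h2.congr fun n => ?_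
    rw [measure_sdiff (Set.subset_iUnion t n) (htm n).nullMeasurableSet
      ((measure_mono (Set.subset_iUnion t n)).trans_lt hfin).ne, Function.comp_apply]
  obtain ⟨n, hn⟩ := (hlim.eventually (ge_mem_nhds (by exact_mod_cast hη : (0 : ℝ≥0∞) < η))).exists
  refine ⟨_, (measurable_const.indicator (htm n)).aestronglyMeasurable, h n, le_trans (le_of_eq ?_)
    (hηε _ hn)⟩
  refine eLpNorm_congr_norm_ae (Eventually.of_forall fun q => ?_)
  by_cases h1 : q ∈ t n
  · have h2 : q ∈ ⋃ n, t n := Set.mem_iUnion.2 ⟨n, h1⟩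
    simp [h1, h2]
  · by_cases h2 : q ∈ ⋃ n, t n <;> simp [h1, h2]

omit [IsProbabilityMeasure P] in
theorem elementary (e : ElementaryIntegrand c τ ℱ) :
    IsSimpleLimit P c τ ℱ fun q => e.value q.1 q.2 := fun ε _ =>
  ⟨[e], by
    have : ((fun q : S × Ω => simpleValue [e] q.1 q.2) - fun q => e.value q.1 q.2) = 0 := by
      funext q
      simp [simpleValue, ElementaryIntegrand.value]
    rw [this]
    simp⟩

omit [IsProbabilityMeasure P] in
theorem rectangle {A : Set S} {F : Set Ω} {a b : ℝ} (hA : MeasurableSet A) (hcA : c A < ∞)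
    (hs : ∀ z ∈ A, a < τ z ∧ τ z ≤ b) (hF : MeasurableSet[ℱ a] F) :
    IsSimpleLimit P c τ ℱ ((A ×ˢ F).indicator fun _ => 1) := by
  let e : ElementaryIntegrand c τ ℱ :=
    { a := a, b := b, A := A, ξ := F.indicator fun _ => 1
      measurableSet := hA
      finite := hcA
      strip := hs
      measurable := measurable_const.indicator hF
      bounded := ⟨1, fun ω => by by_cases h : ω ∈ F <;> simp [h]⟩ }
  have := elementary (P := P) e
  convert this using 2 with q
  by_cases h1 : q.1 ∈ A <;> by_cases h2 : q.2 ∈ F <;>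
    simp [e, ElementaryIntegrand.value, Set.indicator, h1, h2]

end IsSimpleLimit

theorem predictableAlgebra_le (hτ : Measurable τ) :
    predictableAlgebra τ ℱ ≤ (inferInstance : MeasurableSpace (S × Ω)) := by
  refine MeasurableSpace.generateFrom_le ?_
  rintro _ ⟨a, b, A, F, hA, hF, rfl⟩
  exact (hA.inter ((measurableSet_lt measurable_const hτ).inter
    (measurableSet_le hτ measurable_const))).prod (ℱ.le a F hF)

/-- The intersection of two strips starts at max a a', when both events F and F' are already known.
-/
theorem isPiSystem_predictable : IsPiSystem {C : Set (S × Ω) | ∃ (a b : ℝ) (A : Set S) (F : Set Ω),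
    MeasurableSet A ∧ MeasurableSet[ℱ a] F ∧ C = {z | z ∈ A ∧ a < τ z ∧ τ z ≤ b} ×ˢ F} := by
  rintro _ ⟨a, b, A, F, hA, hF, rfl⟩ _ ⟨a', b', A', F', hA', hF', rfl⟩ -
  refine ⟨max a a', min b b', A ∩ A', F ∩ F', hA.inter hA',
    (ℱ.mono (le_max_left a a') F hF).inter (ℱ.mono (le_max_right a a') F' hF'), ?_⟩
  ext q
  simp only [Set.mem_inter_iff, Set.mem_prod, Set.mem_ofPred_eq, max_lt_iff, le_min_iff]
  tauto

theorem measurable_fst_predictable : Measurable[predictableAlgebra τ ℱ] (Prod.fst : S × Ω → S) := by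
  intro A hA
  have : Prod.fst ⁻¹' A = ⋃ n : ℕ, {z | z ∈ A ∧ -(n : ℝ) < τ z ∧ τ z ≤ n} ×ˢ
      (Set.univ : Set Ω) := by
    ext q
    simp only [Set.mem_preimage, Set.mem_iUnion, Set.mem_prod, Set.mem_ofPred_eq, Set.mem_univ,
      and_true, exists_and_left, iff_self_and]
    intro _
    obtain ⟨n, hn⟩ := exists_nat_gt |τ q.1|
    exact ⟨n, (abs_lt.1 hn).1, (abs_lt.1 hn).2.le⟩
  rw [this]
  exact MeasurableSet.iUnion fun n => MeasurableSpace.measurableSet_generateFrom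
    ⟨-n, n, A, Set.univ, hA, MeasurableSet.univ, rfl⟩

variable [IsProbabilityMeasure P] [SigmaFinite c]

/-- A π-λ argument carried out inside sets K N of finite measure and bounded time: without this
localisation, complements could leave L². The sets K N increase to the whole space, so monotone
limits remove it at the end. -/
theorem isSimpleLimit_indicator (hτ : Measurable τ) {C : Set (S × Ω)}
    (hC : MeasurableSet[predictableAlgebra τ ℱ] C) (hfin : (c.prod P) C < ∞) :
    IsSimpleLimit P c τ ℱ (C.indicator fun _ => 1) := by
  let K : ℕ → Set S := fun N => spanningSets c N ∩ {z | -(N : ℝ) < τ z ∧ τ z ≤ N}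
  have hKm : ∀ N, MeasurableSet (K N) := fun N => (measurableSet_spanningSets c N).inter
    ((measurableSet_lt measurable_const hτ).inter (measurableSet_le hτ measurable_const))
  have hKc : ∀ N, c (K N) < ∞ := fun N =>
    (measure_mono Set.inter_subset_left).trans_lt (measure_spanningSets_lt_top c N)
  have hKmono : Monotone K := by
    intro N M hNM z hz
    have : (N : ℝ) ≤ M := by exact_mod_cast hNM
    exact ⟨monotone_spanningSets c hNM hz.1, by linarith [hz.2.1], hz.2.2.trans this⟩
  have hKU : ⋃ N, K N = Set.univ := by
    refine Set.eq_univ_of_forall fun z => ?_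
    obtain ⟨n, hn⟩ := exists_nat_gt |τ z|
    have hz : z ∈ ⋃ N, spanningSets c N := by simp [iUnion_spanningSets c]
    obtain ⟨m, hm⟩ := Set.mem_iUnion.1 hz
    have hle : (n : ℝ) ≤ (max m n : ℕ) := by exact_mod_cast le_max_right m n
    exact Set.mem_iUnion.2 ⟨max m n, monotone_spanningSets c (le_max_left m n) hm,
      by linarith [(abs_lt.1 hn).1], ((abs_lt.1 hn).2.le).trans hle⟩
  have hKP : ∀ N, (c.prod P) (K N ×ˢ Set.univ) < ∞ := fun N => by
    rw [Measure.prod_prod, measure_univ, mul_one]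
    exact hKc N
  have hm := predictableAlgebra_le (Ω := Ω) (ℱ := ℱ) hτ
  have main : ∀ N, ∀ t, MeasurableSet[predictableAlgebra τ ℱ] t →
      IsSimpleLimit P c τ ℱ ((t ∩ K N ×ˢ Set.univ).indicator fun _ => 1) := by
    intro N
    have hKN : MeasurableSet (K N ×ˢ (Set.univ : Set Ω)) := (hKm N).prod MeasurableSet.univ
    refine MeasurableSpace.induction_on_inter rfl isPiSystem_predictable ?_ ?_ ?_ ?_
    · simp only [Set.empty_inter, Set.indicator_empty]
      exact fun ε _ => ⟨[], by simp [simpleValue]⟩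
    · rintro _ ⟨a, b, A, F, hA, hF, rfl⟩
      rw [Set.prod_inter_prod, Set.inter_univ]
      refine IsSimpleLimit.rectangle ((hA.inter ((measurableSet_lt measurable_const hτ).inter
        (measurableSet_le hτ measurable_const))).inter (hKm N))
        ((measure_mono Set.inter_subset_right).trans_lt (hKc N)) (fun z hz => hz.1.2) hF
    -- The complement within K N has indicator 1_{K N} - 1_{t ∩ K N}.
    · intro t ht h
      have hK := IsSimpleLimit.rectangle (P := P) (ℱ := ℱ) (F := Set.univ) (hKm N) (hKc N)
        (fun z hz => hz.2) MeasurableSet.univ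
      have := hK.add (measurable_const.indicator hKN).aestronglyMeasurable
        ((measurable_const.indicator ((hm t ht).inter hKN)).const_mul (-1)).aestronglyMeasurable
        (h.const_mul (-1))
      convert this using 2 with q
      by_cases h1 : q ∈ t <;> by_cases h2 : q ∈ K N ×ˢ (Set.univ : Set Ω) <;>
        simp only [Set.indicator, Set.mem_inter_iff, Set.mem_compl_iff, h1, h2] <;> norm_num
    · intro f hd hf h
      -- A disjoint union is the increasing union of its finite partial unions, whose indicators are
      -- finite sums.
      rw [Set.iUnion_inter, ← Set.iUnion_accumulate]
      have hfm : ∀ n, MeasurableSet (f n ∩ K N ×ˢ (Set.univ : Set Ω)) :=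
        fun n => (hm _ (hf n)).inter hKN
      have ham : ∀ n, MeasurableSet (Set.accumulate (fun n => f n ∩ K N ×ˢ (Set.univ : Set Ω)) n) :=
        fun n => MeasurableSet.biUnion (Set.to_countable _) fun i _ => hfm i
      refine IsSimpleLimit.indicator_iUnion Set.monotone_accumulate ham ?_ fun n => ?_
      · rw [Set.iUnion_accumulate, ← Set.iUnion_inter]
        exact (measure_mono Set.inter_subset_right).trans_lt (hKP N)
      · induction n with
        | zero => rw [Set.accumulate_zero_nat]; exact h 0
        | succ n ih =>
          have hdis : Disjoint (Set.accumulate (fun n => f n ∩ K N ×ˢ (Set.univ : Set Ω)) n)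
              (f (n + 1) ∩ K N ×ˢ (Set.univ : Set Ω)) :=
            Set.disjoint_accumulate (fun i j hij => (hd hij).mono Set.inter_subset_left
              Set.inter_subset_left) (Nat.lt_succ_self n)
          rw [Set.accumulate_succ, Set.indicator_union_of_disjoint hdis]
          exact ih.add (measurable_const.indicator (ham n)).aestronglyMeasurable
            (measurable_const.indicator (hfm (n + 1))).aestronglyMeasurable (h (n + 1))
  have hCU : ⋃ N, (C ∩ K N ×ˢ Set.univ) = C := by
    rw [← Set.inter_iUnion, ← Set.iUnion_prod_const, hKU, Set.univ_prod_univ, Set.inter_univ]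
  rw [← hCU] at hfin ⊢
  exact IsSimpleLimit.indicator_iUnion
    (fun N M hNM => Set.inter_subset_inter_right _ (Set.prod_mono_left (hKmono hNM)))
    (fun N => (hm C hC).inter ((hKm N).prod MeasurableSet.univ)) hfin fun N => main N C hC

theorem isSimpleLimit_of_predictable (hτ : Measurable τ) {φ : S × Ω → ℝ}
    (hφ : MemLp φ 2 (c.prod P)) (hφm : Measurable[predictableAlgebra τ ℱ] φ) :
    IsSimpleLimit P c τ ℱ φ := by
  refine MemLp.induction_stronglyMeasurable (predictableAlgebra_le hτ) (by norm_num)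
    (fun φ => IsSimpleLimit P c τ ℱ φ) ?_ ?_ ?_ ?_ hφ hφm.stronglyMeasurable.aestronglyMeasurable
  · intro r s hs hsfin
    refine ((isSimpleLimit_indicator hτ hs hsfin).const_mul r).congr_ae
      (Eventually.of_forall fun q => ?_)
    by_cases h : q ∈ s <;> simp [h]
  · intro f h _ hf hh _ _ hf' hh'
    exact hf'.add hf.1 hh.1 hh'
  · refine isClosed_of_closure_subset fun f hf => ?_
    refine IsSimpleLimit.of_forall_exists (Lp.aestronglyMeasurable _) fun ε hε => ?_
    obtain ⟨h, hh, hd⟩ := EMetric.mem_closure_iff.1 hf ε (pos_iff_ne_zero.2 hε)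
    refine ⟨h, Lp.aestronglyMeasurable _, hh, ?_⟩
    rw [edist_comm, Subtype.edist_eq, Lp.edist_def] at hd
    exact hd.le
  · exact fun f h hfh _ hf => hf.congr_ae hfh

end Density

/-! ### Integrands modulated by a stationary field -/

section Modulated

variable {Ω S : Type*} [mΩ : MeasurableSpace Ω] [MeasurableSpace S] {d : ℕ}
  {P : Measure Ω} {c : Measure S} {τ : S → ℝ} {ℱ : Filtration ℝ mΩ} {σ : Space d → Ω → ℝ}

theorem StrictlyStationary.eLpNorm_eq (hσ : StrictlyStationary P σ) (s : Space d) :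
    eLpNorm (σ s) 2 P = eLpNorm (σ 0) 2 P := by
  have h := (hσ s 1 fun _ => 0).comp (measurable_pi_apply (0 : Fin 1))
  simp only [Function.comp_def, zero_add] at h
  exact h.eLpNorm_eq 2

/-- By Tonelli the inner integral over Ω is k(z)² E σ(ρ z)², and stationarity makes the second
factor independent of z. The map ρ is the projection onto ℝ^d for X and the identity for Z. -/
theorem eLpNorm_modulated [IsProbabilityMeasure P] [SFinite c] (hσ : StrictlyStationary P σ)
    {k : S → ℝ} (hk : Measurable k) {ρ : S → Space d}
    (hσρ : Measurable fun q : S × Ω => σ (ρ q.1) q.2) :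
    eLpNorm (fun q : S × Ω => k q.1 * σ (ρ q.1) q.2) 2 (c.prod P) =
      eLpNorm k 2 c * eLpNorm (σ 0) 2 P := by
  have hm : Measurable fun q : S × Ω => ‖k q.1 * σ (ρ q.1) q.2‖ₑ ^ 2 :=
    ((hk.comp measurable_fst).mul hσρ).enorm.pow_const 2
  refine (ENNReal.pow_right_strictMono two_ne_zero).injective ?_
  show _ ^ 2 = _ ^ 2
  rw [mul_pow, eLpNorm_two_sq, eLpNorm_two_sq k, lintegral_prod _ hm.aemeasurable,
    ← lintegral_mul_const _ (by fun_prop)]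
  refine lintegral_congr fun z => ?_
  rw [← hσ.eLpNorm_eq (ρ z), eLpNorm_two_sq]
  have : Measurable fun ω => σ (ρ z) ω := hσρ.comp measurable_prodMk_left
  simp only [enorm_mul, mul_pow]
  rw [lintegral_const_mul _ (by fun_prop)]

variable [NeZero d]

theorem measurable_time : Measurable (time : Space d → ℝ) := by
  unfold time
  fun_prop

/-- Under (z, ω) ↦ (ρ z, ω) a generating rectangle pulls back to a generating rectangle for the time
ρ-composed. So predictability of σ over ℝ^d suffices for integrands over 𝒳 × ℝ^d. -/
theorem measurable_field_comp {ρ : S → Space d} (hρ : Measurable ρ)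
    (hσ : Measurable[predictableAlgebra time ℱ] (Function.uncurry σ)) :
    Measurable[predictableAlgebra (fun z => time (ρ z)) ℱ] fun q : S × Ω => σ (ρ q.1) q.2 := by
  have h : @Measurable _ _ (predictableAlgebra (fun z => time (ρ z)) ℱ)
      (predictableAlgebra time ℱ) fun q : S × Ω => (ρ q.1, q.2) := by
    refine @measurable_generateFrom _ _ (predictableAlgebra (fun z => time (ρ z)) ℱ) _ _ ?_
    rintro _ ⟨a, b, A, F, hA, hF, rfl⟩
    exact MeasurableSpace.measurableSet_generateFrom ⟨a, b, ρ ⁻¹' A, F, hρ hA, hF, rfl⟩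
  exact hσ.comp h

theorem exists_isStochIntegral_modulated [IsProbabilityMeasure P] [SigmaFinite c]
    {W : Set S → Ω → ℝ} {ρ : S → Space d} (hρ : Measurable ρ) (hW : IsGaussianBasis P c W)
    (hC : IsCompatible P c (fun z => time (ρ z)) ℱ W) (hstat : StrictlyStationary P σ)
    (hσ2 : MemLp (σ 0) 2 P) (hσ : Measurable[predictableAlgebra time ℱ] (Function.uncurry σ))
    {k : S → ℝ} (hk : Measurable k) (hk2 : MemLp k 2 c) :
    ∃ Y, IsStochIntegral P c (fun z => time (ρ z)) ℱ W (fun z ω => k z * σ (ρ z) ω) Y := by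
  have hτ : Measurable fun z => time (ρ z) := measurable_time.comp hρ
  have hσρ := measurable_field_comp hρ hσ
  have hσρ' := hσρ.mono (predictableAlgebra_le hτ) le_rfl
  have hφ : Measurable[predictableAlgebra (fun z => time (ρ z)) ℱ]
      fun q : S × Ω => k q.1 * σ (ρ q.1) q.2 :=
    (hk.comp measurable_fst_predictable).mul hσρ
  have hφ2 : MemLp (fun q : S × Ω => k q.1 * σ (ρ q.1) q.2) 2 (c.prod P) :=
    ⟨(hφ.mono (predictableAlgebra_le hτ) le_rfl).aestronglyMeasurable, by
      rw [eLpNorm_modulated hstat hk hσρ']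
      exact ENNReal.mul_lt_top hk2.2 hσ2.2⟩
  exact (isSimpleLimit_of_predictable hτ hφ2 hφ).exists_isStochIntegral hτ hW hC hφ2

end Modulated

/-! ### Integrals of deterministic integrands are Gaussian -/

section Gaussian

variable {Ω S : Type*} [mΩ : MeasurableSpace Ω] [MeasurableSpace S]
  {P : Measure Ω} {c : Measure S} {τ : S → ℝ} {ℱ : Filtration ℝ mΩ} {W : Set S → Ω → ℝ}

/-- Enumerate the index type inside ℕ and put ∅ at all other positions. -/
theorem IsGaussianBasis.iIndepFun_of_fintype (hW : IsGaussianBasis P c W) {ι : Type*} [Fintype ι]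
    {A : ι → Set S} (hA : ∀ i, MeasurableSet (A i)) (hcA : ∀ i, c (A i) < ∞)
    (hd : Pairwise (Function.onFun Disjoint A)) : iIndepFun (fun i => W (A i)) P := by
  classical
  let g : ι → ℕ := fun i => Fintype.equivFin ι i
  have hg : Function.Injective g := fun i j h => (Fintype.equivFin ι).injective (Fin.ext h)
  let D : ℕ → Set S := Function.extend g A fun _ => ∅
  have hD : ∀ i, D (g i) = A i := fun i => hg.extend_apply _ _ _
  have hD' : ∀ n, (∃ i, g i = n) ∨ D n = ∅ := fun n => by
    by_cases h : ∃ i, g i = n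
    · exact Or.inl h
    · exact Or.inr (Function.extend_apply' _ _ _ h)
  have key : iIndepFun (fun n => W (D n)) P := by
    refine hW.indep D (fun n => ?_) (fun n => ?_) fun n m hnm => ?_
    · rcases hD' n with ⟨i, rfl⟩ | h
      · rw [hD]; exact hA i
      · rw [h]; exact MeasurableSet.empty
    · rcases hD' n with ⟨i, rfl⟩ | h
      · rw [hD]; exact hcA i
      · rw [h]; simp
    · rcases hD' n with ⟨i, rfl⟩ | h
      · rcases hD' m with ⟨j, rfl⟩ | h'
        · simp only [Function.onFun, hD]
          exact hd fun hij => hnm (congrArg g hij)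
        · simp [Function.onFun, h']
      · simp [Function.onFun, h]
  have := key.precomp hg
  simpa only [hD] using this

theorem IsGaussianBasis.hasGaussianLaw_const_mul (hW : IsGaussianBasis P c W) {A : Set S}
    (hA : MeasurableSet A) (hcA : c A < ∞) (r : ℝ) : HasGaussianLaw (fun ω => r * W A ω) P := by
  have h : HasGaussianLaw (W A) P := ⟨by rw [hW.law A hA hcA]; infer_instance⟩
  exact h.fun_smul r

/-- A simple function supported in a bounded time strip is a simple integrand with Gaussian
integral. -/
theorem exists_simple_of_simpleFunc (hW : IsGaussianBasis P c W) (s : SimpleFunc S ℝ)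
    (hs : MemLp s 2 c) {a b : ℝ} (hab : ∀ z, s z ≠ 0 → a < τ z ∧ τ z ≤ b) :
    ∃ l : List (ElementaryIntegrand c τ ℱ), (∀ z ω, simpleValue l z ω = s z) ∧
      HasGaussianLaw (simpleIntegral W l) P := by
  classical
  -- The level set of 0 is dropped: it may have infinite measure and need not lie in the strip.
  let F := s.range.erase 0
  have hF : ∀ y : F, (y : ℝ) ≠ 0 := fun y => Finset.ne_of_mem_erase y.2
  have hfin : ∀ y : F, c (s ⁻¹' {(y : ℝ)}) < ∞ := fun y =>
    SimpleFunc.measure_preimage_lt_top_of_memLp (by norm_num) (by norm_num) s hs y (hF y)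
  let e : F → ElementaryIntegrand c τ ℱ := fun y =>
    { a := a, b := b, A := s ⁻¹' {(y : ℝ)}, ξ := fun _ => y
      measurableSet := s.measurableSet_fiber _
      finite := hfin y
      strip := fun z hz => hab z (by
        rw [Set.mem_preimage, Set.mem_singleton_iff] at hz
        rw [hz]
        exact hF y)
      measurable := measurable_const
      bounded := ⟨|(y : ℝ)|, fun _ => le_rfl⟩ }
  refine ⟨(Finset.univ : Finset F).toList.map e, fun z ω => ?_, ?_⟩
  · simp only [simpleValue, List.map_map, Finset.sum_map_toList, Function.comp_def, e]
    by_cases hz : s z = 0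
    · rw [hz]
      refine Finset.sum_eq_zero fun y _ => ?_
      have : z ∉ s ⁻¹' {(y : ℝ)} := fun h => hF y (by
        rw [Set.mem_preimage, Set.mem_singleton_iff] at h
        rw [← h, hz])
      simp only [Set.indicator_of_notMem this, mul_zero]
    · let y₀ : F := ⟨s z, Finset.mem_erase.2 ⟨hz, s.mem_range_self z⟩⟩
      rw [Finset.sum_eq_single y₀]
      · simp [y₀]
      · intro y _ hy
        have : z ∉ s ⁻¹' {(y : ℝ)} := fun h => hy (Subtype.ext (by
          rw [Set.mem_preimage, Set.mem_singleton_iff] at h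
          exact h.symm))
        simp only [Set.indicator_of_notMem this, mul_zero]
      · simp
  · have hsum : simpleIntegral W ((Finset.univ : Finset F).toList.map e) =
        fun ω => ∑ y : F, (y : ℝ) * W (s ⁻¹' {(y : ℝ)}) ω := by
      funext ω
      simp only [simpleIntegral, List.map_map, Finset.sum_map_toList, Function.comp_def, e]
    rw [hsum]
    have hi := hW.iIndepFun_of_fintype (A := fun y : F => s ⁻¹' {(y : ℝ)})
      (fun y => s.measurableSet_fiber _) hfin fun y y' hyy' =>
        Disjoint.preimage s (by simpa using fun h => hyy' (Subtype.ext h))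
    exact iIndepFun.hasGaussianLaw_fun_sum
      (fun y : F => hW.hasGaussianLaw_const_mul (s.measurableSet_fiber _) (hfin y) (y : ℝ))
      (hi.comp (fun y x => (y : ℝ) * x) fun y => by fun_prop)

/-- The measure |h|² dc is finite, so by continuity from above its mass outside (-N, N] tends to 0.
Elementary integrands live in bounded time strips, hence the truncation. -/
theorem exists_eLpNorm_indicator_strip_sub_le (hτ : Measurable τ) {h : S → ℝ}
    (hh : MemLp h 2 c) {ε : ℝ≥0∞} (hε : ε ≠ 0) :
    ∃ N : ℕ, eLpNorm (h - {z | -(N : ℝ) < τ z ∧ τ z ≤ N}.indicator h) 2 c ≤ ε := by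
  let K : ℕ → Set S := fun N => {z | -(N : ℝ) < τ z ∧ τ z ≤ N}
  have hK : ∀ N, MeasurableSet (K N) := fun N =>
    (measurableSet_lt measurable_const hτ).inter (measurableSet_le hτ measurable_const)
  let ν := c.withDensity fun z => ‖h z‖ₑ ^ 2
  have hν : ν Set.univ ≠ ∞ := by
    rw [withDensity_apply _ MeasurableSet.univ, setLIntegral_univ, ← eLpNorm_two_sq]
    exact (ENNReal.pow_lt_top hh.2).ne
  have h1 := tendsto_measure_iInter_atTop (μ := ν) (s := fun N => (K N)ᶜ)
    (fun N => (hK N).compl.nullMeasurableSet) (fun N M hNM => by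
      refine Set.compl_subset_compl.2 fun z hz => ?_
      have : (N : ℝ) ≤ M := by exact_mod_cast hNM
      exact ⟨by linarith [hz.1], hz.2.trans this⟩)
    ⟨0, ((measure_mono (Set.subset_univ _)).trans_lt hν.lt_top).ne⟩
  have h2 : ⋂ N, (K N)ᶜ = ∅ := by
    rw [← Set.compl_iUnion, Set.compl_empty_iff]
    refine Set.eq_univ_of_forall fun z => ?_
    obtain ⟨n, hn⟩ := exists_nat_gt |τ z|
    exact Set.mem_iUnion.2 ⟨n, (abs_lt.1 hn).1, (abs_lt.1 hn).2.le⟩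
  rw [h2, measure_empty] at h1
  obtain ⟨N, hN⟩ := (h1.eventually (ge_mem_nhds
    (pos_iff_ne_zero.2 (pow_ne_zero 2 hε)))).exists
  refine ⟨N, ?_⟩
  rw [← ENNReal.pow_le_pow_left_iff two_ne_zero]
  refine le_trans (le_of_eq ?_) hN
  rw [eLpNorm_two_sq, Function.comp_apply, withDensity_apply _ (hK N).compl,
    ← lintegral_indicator (hK N).compl]
  refine lintegral_congr fun z => ?_
  by_cases hz : z ∈ K N
  · have hz' : z ∈ {z | -(N : ℝ) < τ z ∧ τ z ≤ N} := hz
    simp [hz, Set.indicator_of_mem hz']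
  · have hz' : z ∉ {z | -(N : ℝ) < τ z ∧ τ z ≤ N} := hz
    simp [hz, Set.indicator_of_notMem hz']

theorem exists_gaussian_simple (hτ : Measurable τ) (hW : IsGaussianBasis P c W) {h : S → ℝ}
    (hh : MemLp h 2 c) {ε : ℝ≥0∞} (hε : ε ≠ 0) :
    ∃ (s : S → ℝ) (l : List (ElementaryIntegrand c τ ℱ)), (∀ z ω, simpleValue l z ω = s z) ∧
      HasGaussianLaw (simpleIntegral W l) P ∧ AEStronglyMeasurable s c ∧
      eLpNorm (s - h) 2 c ≤ ε := by
  obtain ⟨N, hN⟩ := exists_eLpNorm_indicator_strip_sub_le hτ hh (ε := ε / 2) (by simpa using hε)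
  set K := {z | -(N : ℝ) < τ z ∧ τ z ≤ N} with hKdef
  have hK : MeasurableSet K :=
    (measurableSet_lt measurable_const hτ).inter (measurableSet_le hτ measurable_const)
  obtain ⟨s, hs, hs2⟩ := hh.exists_simpleFunc_eLpNorm_sub_lt (by norm_num) (ε := ε / 2)
    (by simpa using hε)
  have hr : (s.restrict K : S → ℝ) = K.indicator s := SimpleFunc.coe_restrict _ hK
  have hr2 : MemLp (s.restrict K) 2 c := by rw [hr]; exact hs2.indicator hK
  obtain ⟨l, hl, hG⟩ := exists_simple_of_simpleFunc (τ := τ) (ℱ := ℱ) hW (s.restrict K) hr2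
    (a := -N) (b := N) fun z hz => by
      rw [hr] at hz
      exact (Set.mem_of_indicator_ne_zero hz : z ∈ K)
  refine ⟨_, l, hl, hG, hr2.1, ?_⟩
  -- Half of ε pays for the truncation in time and half for the simple approximation, whose error
  -- does not grow under restriction to K.
  rw [eLpNorm_sub_comm, ← sub_add_sub_cancel h (K.indicator h), hr, ← Set.indicator_sub']
  refine (eLpNorm_add_le (hh.1.sub (hh.indicator hK).1) ((hh.sub hs2).indicator hK).1
    one_le_two).trans ?_
  exact (add_le_add hN ((eLpNorm_indicator_le _).trans hs.le)).trans (ENNReal.add_halves ε).le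

theorem variance_eq_toReal_eLpNorm_sq {Y : Ω → ℝ} (hY : MemLp Y 2 P) (h0 : ∫ ω, Y ω ∂P = 0) :
    variance Y P = (eLpNorm Y 2 P).toReal ^ 2 := by
  rw [variance_of_integral_eq_zero hY.1.aemeasurable h0, ← ENNReal.toReal_pow,
    eLpNorm_two_sq_eq_ofReal_integral hY, ENNReal.toReal_ofReal]
  exact integral_nonneg fun ω => by positivity

/-- `L²`-limits of centred Gaussian variables are Gaussian. -/
theorem map_eq_gaussianReal_of_tendsto [IsProbabilityMeasure P] {X : ℕ → Ω → ℝ} {Y : Ω → ℝ}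
    (hX2 : ∀ n, MemLp (X n) 2 P) (hY : MemLp Y 2 P) (hX0 : ∀ n, ∫ ω, X n ω ∂P = 0)
    (hX : ∀ n, HasGaussianLaw (X n) P)
    (hlim : Tendsto (fun n => eLpNorm (X n - Y) 2 P) atTop (𝓝 0)) :
    P.map Y = gaussianReal 0 ((eLpNorm Y 2 P).toReal ^ 2).toNNReal := by
  have hnorm : Tendsto (fun n => (eLpNorm (X n) 2 P).toReal) atTop (𝓝 (eLpNorm Y 2 P).toReal) := by
    have := ((Lp.tendsto_Lp_iff_tendsto_eLpNorm'' _ hX2 _ hY).2 hlim).norm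
    simpa only [Lp.norm_toLp] using this
  obtain ⟨ns, hns, hae⟩ := (tendstoInMeasure_of_tendsto_eLpNorm (by norm_num) (fun n => (hX2 n).1)
    hY.1 hlim).exists_seq_tendsto_ae
  have : IsProbabilityMeasure (P.map Y) := Measure.isProbabilityMeasure_map hY.1.aemeasurable
  -- Along an almost surely convergent subsequence the characteristic functions have two limits:
  -- that of Y, by dominated convergence, and the Gaussian one, since the variances converge.
  refine Measure.ext_of_charFun (funext fun θ => ?_)
  have hchar : ∀ {V : Ω → ℝ}, MemLp V 2 P →
      charFun (P.map V) θ = ∫ ω, Complex.exp (θ * V ω * Complex.I) ∂P := fun hV => by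
    rw [charFun_apply_real, integral_map hV.1.aemeasurable]
    fun_prop
  have l1 : Tendsto (fun n => charFun (P.map (X (ns n))) θ) atTop (𝓝 (charFun (P.map Y) θ)) := by
    simp only [hchar (hX2 _), hchar hY]
    refine tendsto_integral_of_dominated_convergence (fun _ => 1) (fun n => ?_)
      (integrable_const 1) (fun n => Eventually.of_forall fun ω => ?_) ?_
    · exact Continuous.comp_aestronglyMeasurable (g := fun x : ℝ => Complex.exp (θ * x * Complex.I))
        (by fun_prop) (hX2 (ns n)).1
    · rw [← Complex.ofReal_mul, Complex.norm_exp_ofReal_mul_I]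
    · filter_upwards [hae] with ω hω
      exact ((by fun_prop : Continuous fun x : ℝ =>
        Complex.exp (θ * x * Complex.I)).tendsto _).comp hω
  have l2 : Tendsto (fun n => charFun (P.map (X (ns n))) θ) atTop
      (𝓝 (Complex.exp (-((((eLpNorm Y 2 P).toReal ^ 2 : ℝ) : ℂ) * θ ^ 2 / 2)))) := by
    have hc : Continuous fun x : ℝ => Complex.exp (-(((x ^ 2 : ℝ) : ℂ) * θ ^ 2 / 2)) := by
      fun_prop
    refine ((hc.tendsto _).comp (hnorm.comp hns.tendsto_atTop)).congr fun n => ?_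
    rw [(hX (ns n)).map_eq_gaussianReal, charFun_gaussianReal, hX0,
      variance_eq_toReal_eLpNorm_sq (hX2 _) (hX0 _), Real.coe_toNNReal _ (by positivity)]
    simp
  rw [tendsto_nhds_unique l1 l2, charFun_gaussianReal, Real.coe_toNNReal _ (by positivity)]
  simp

variable [IsProbabilityMeasure P] [SFinite c]

theorem IsStochIntegral.map_eq_gaussianReal (hτ : Measurable τ) (hW : IsGaussianBasis P c W)
    (hC : IsCompatible P c τ ℱ W) {h : S → ℝ} (hm : Measurable h) (hh : MemLp h 2 c)
    {Y : Ω → ℝ} (hY : IsStochIntegral P c τ ℱ W (fun z _ => h z) Y) :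
    P.map Y = gaussianReal 0 ((eLpNorm Y 2 P).toReal ^ 2).toNNReal := by
  have hex := fun n : ℕ => exists_gaussian_simple (ℱ := ℱ) hτ hW hh
    (ε := ((n : ℝ≥0∞) + 1)⁻¹) (by simp)
  choose s l hl hG hsm hs using hex
  have hlim : Tendsto (fun n : ℕ => ((n : ℝ≥0∞) + 1)⁻¹) atTop (𝓝 0) := by
    have := (tendsto_add_atTop_iff_nat 1).2 ENNReal.tendsto_inv_nat_nhds_zero
    simpa using this
  have hmf : AEStronglyMeasurable (fun q : S × Ω => h q.1) (c.prod P) :=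
    (hm.comp measurable_fst).aestronglyMeasurable
  have hd : ∀ n, eLpNorm (simpleIntegral W (l n) - Y) 2 P ≤ ((n : ℝ≥0∞) + 1)⁻¹ := fun n => by
    have hsimple : IsStochIntegral P c τ ℱ W (simpleValue (l n)) (simpleIntegral W (l n)) :=
      ⟨memLp_simpleIntegral hW (l n), fun _ => l n, by simp, by simp⟩
    -- The isometry for the difference, whose integrand depends on z only; as P has mass one, its
    -- norm is a norm over S.
    have e := (hsimple.sub hW (memLp_simpleValue (l n)).1 hmf hY).eLpNorm_eq hτ hW hC
      ((memLp_simpleValue (l n)).1.sub hmf)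
    refine e.trans_le (le_trans (le_of_eq ?_) (hs n))
    simp only [hl]
    exact eLpNorm_comp_measurePreserving (f := Prod.fst) (g := s n - h) ((hsm n).sub hh.1)
      (measurePreserving_fst (ν := P))
  exact map_eq_gaussianReal_of_tendsto (fun n => memLp_simpleIntegral hW (l n)) hY.1
    (fun n => integral_simpleIntegral hW hC (l n)) hG
    (tendsto_of_tendsto_of_tendsto_of_le_of_le tendsto_const_nhds hlim (fun n => zero_le) hd)

end Gaussian

/-! ### Covariances and finite-dimensional distributions -/

section Covariance

variable {Ω : Type*} [mΩ : MeasurableSpace Ω] {P : Measure Ω}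

/-- Polarisation: expand the variance of Y - Y'. Covariances thereby become a matter of norms, to
which the isometry applies. -/
theorem covariance_eq_of_eLpNorm [IsFiniteMeasure P] {Y Y' : Ω → ℝ} (hY : MemLp Y 2 P)
    (hY' : MemLp Y' 2 P) (h0 : ∫ ω, Y ω ∂P = 0) (h0' : ∫ ω, Y' ω ∂P = 0) :
    covariance Y Y' P = ((eLpNorm Y 2 P).toReal ^ 2 + (eLpNorm Y' 2 P).toReal ^ 2 -
      (eLpNorm (fun ω => Y ω - Y' ω) 2 P).toReal ^ 2) / 2 := by
  have h1 := variance_sub hY hY'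
  have h2 : ∫ ω, (Y - Y') ω ∂P = 0 := by
    rw [integral_sub' (hY.integrable one_le_two) (hY'.integrable one_le_two), h0, h0', sub_zero]
  rw [variance_eq_toReal_eLpNorm_sq (hY.sub hY') h2, variance_eq_toReal_eLpNorm_sq hY h0,
    variance_eq_toReal_eLpNorm_sq hY' h0'] at h1
  have h3 : eLpNorm (fun ω => Y ω - Y' ω) 2 P = eLpNorm (Y - Y') 2 P := rfl
  rw [h3]
  linarith

theorem covariance_eq_sq_mul [IsFiniteMeasure P] {X X' Z Z' : Ω → ℝ} {κ : ℝ} (hX : MemLp X 2 P) (hX' : MemLp X' 2 P)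
    (hZ : MemLp Z 2 P) (hZ' : MemLp Z' 2 P) (hX0 : ∫ ω, X ω ∂P = 0) (hX0' : ∫ ω, X' ω ∂P = 0)
    (hZ0 : ∫ ω, Z ω ∂P = 0) (hZ0' : ∫ ω, Z' ω ∂P = 0)
    (h : eLpNorm Z 2 P = ‖κ‖ₑ * eLpNorm X 2 P) (h' : eLpNorm Z' 2 P = ‖κ‖ₑ * eLpNorm X' 2 P)
    (hd : eLpNorm (fun ω => Z ω - Z' ω) 2 P = ‖κ‖ₑ * eLpNorm (fun ω => X ω - X' ω) 2 P) :
    covariance Z Z' P = κ ^ 2 * covariance X X' P := by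
  rw [covariance_eq_of_eLpNorm hX hX' hX0 hX0', covariance_eq_of_eLpNorm hZ hZ' hZ0 hZ0', h, h', hd]
  simp only [ENNReal.toReal_mul, toReal_enorm, mul_pow, Real.norm_eq_abs, sq_abs]
  ring

/-- The factor κ² in the numerator cancels |κ|·|κ| in the denominator. Vanishing variances need no
separate case, since the cancellation only uses κ ≠ 0. -/
theorem correlation_eq_of_covariance {X X' Z Z' : Ω → ℝ} {κ : ℝ} (hκ : κ ≠ 0)
    (hX : MemLp X 2 P) (hX' : MemLp X' 2 P) (hZ : MemLp Z 2 P) (hZ' : MemLp Z' 2 P)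
    (h : covariance Z Z' P = κ ^ 2 * covariance X X' P)
    (h1 : covariance Z Z P = κ ^ 2 * covariance X X P)
    (h2 : covariance Z' Z' P = κ ^ 2 * covariance X' X' P) :
    correlation P Z Z' = correlation P X X' := by
  rw [covariance_self hZ.1.aemeasurable, covariance_self hX.1.aemeasurable] at h1
  rw [covariance_self hZ'.1.aemeasurable, covariance_self hX'.1.aemeasurable] at h2
  rw [correlation, correlation, h, h1, h2, Real.sqrt_mul (sq_nonneg κ), Real.sqrt_mul (sq_nonneg κ),
    Real.sqrt_sq_eq_abs, mul_mul_mul_comm, abs_mul_abs_self, ← sq,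
    mul_div_mul_left _ _ (pow_ne_zero 2 hκ)]

/-- Cramér-Wold: the characteristic function of a vector at a functional L is that of a scalar
linear combination, here a centred Gaussian, whose variance is a quadratic form in the covariances.
-/
theorem sameFDD_of_gaussian [IsProbabilityMeasure P] {T : Type*} {X Z : T → Ω → ℝ} (hX : ∀ t, MemLp (X t) 2 P)
    (hZ : ∀ t, MemLp (Z t) 2 P)
    (hXg : ∀ (n : ℕ) (t : Fin n → T) (θ : Fin n → ℝ), P.map (fun ω => ∑ i, θ i * X (t i) ω) =
      gaussianReal 0 (variance (fun ω => ∑ i, θ i * X (t i) ω) P).toNNReal)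
    (hZg : ∀ (n : ℕ) (t : Fin n → T) (θ : Fin n → ℝ), P.map (fun ω => ∑ i, θ i * Z (t i) ω) =
      gaussianReal 0 (variance (fun ω => ∑ i, θ i * Z (t i) ω) P).toNNReal)
    (hcov : ∀ t t', covariance (Z t) (Z t') P = covariance (X t) (X t') P) :
    SameFDD P Z X := by
  intro n t
  have hZm : AEMeasurable (fun ω i => Z (t i) ω) P :=
    aemeasurable_pi_lambda _ fun i => (hZ (t i)).1.aemeasurable
  have hXm : AEMeasurable (fun ω i => X (t i) ω) P :=
    aemeasurable_pi_lambda _ fun i => (hX (t i)).1.aemeasurable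
  refine ⟨hZm, hXm, ?_⟩
  have := Measure.isProbabilityMeasure_map hZm
  have := Measure.isProbabilityMeasure_map hXm
  refine Measure.ext_of_charFunDual (funext fun L => ?_)
  rw [charFunDual_eq_charFun_map_one, charFunDual_eq_charFun_map_one,
    AEMeasurable.map_map_of_aemeasurable (by fun_prop) hZm,
    AEMeasurable.map_map_of_aemeasurable (by fun_prop) hXm]
  congr 1
  have hL : ∀ x : Fin n → ℝ, L x = ∑ i, L (Pi.single i 1) * x i := fun x => by
    conv_lhs => rw [← Finset.univ_sum_single x]
    rw [map_sum]
    refine Finset.sum_congr rfl fun i _ => ?_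
    have : Pi.single i (x i) = x i • (Pi.single i (1 : ℝ) : Fin n → ℝ) := by
      rw [← Pi.single_smul, smul_eq_mul, mul_one]
    rw [this, map_smul, smul_eq_mul, mul_comm]
  have hvar : ∀ {V : T → Ω → ℝ}, (∀ t, MemLp (V t) 2 P) →
      variance (fun ω => ∑ i, L (Pi.single i 1) * V (t i) ω) P =
        ∑ i, ∑ j, L (Pi.single i 1) * (L (Pi.single j 1) * covariance (V (t i)) (V (t j)) P) := by
    intro V hV
    rw [variance_fun_sum' fun i _ => (hV (t i)).const_mul _]
    refine Finset.sum_congr rfl fun i _ => Finset.sum_congr rfl fun j _ => ?_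
    rw [covariance_const_mul_left, covariance_const_mul_right]
  have hLV : ∀ V : T → Ω → ℝ, (L ∘ fun ω i => V (t i) ω) =
      fun ω => ∑ i, L (Pi.single i 1) * V (t i) ω := fun V => funext fun ω => hL _
  rw [hLV, hLV, hXg, hZg, hvar hX, hvar hZ]
  simp only [hcov]

end Covariance

/-! ### Linear combinations of integrals, constant volatility, and norms of modulated integrals -/

section ConstantVolatility

variable {Ω S : Type*} [mΩ : MeasurableSpace Ω] [MeasurableSpace S]
  {P : Measure Ω} [IsProbabilityMeasure P] {c : Measure S} {τ : S → ℝ} {ℱ : Filtration ℝ mΩ}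
  {W : Set S → Ω → ℝ}

theorem IsStochIntegral.sum_const_mul (hW : IsGaussianBasis P c W) {ι : Type*} (s : Finset ι)
    {k : ι → S → ℝ} (hk : ∀ i, Measurable (k i)) (θ : ι → ℝ) {Y : ι → Ω → ℝ}
    (hY : ∀ i, IsStochIntegral P c τ ℱ W (fun z _ => k i z) (Y i)) :
    IsStochIntegral P c τ ℱ W (fun z _ => ∑ i ∈ s, θ i * k i z) fun ω => ∑ i ∈ s, θ i * Y i ω := by
  classical
  induction s using Finset.induction_on with
  | empty =>
    simp only [Finset.sum_empty]
    exact ⟨MemLp.zero, fun _ => [], by simp [simpleValue], by simp [simpleIntegral]⟩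
  | insert i s hi ih =>
    simp only [Finset.sum_insert hi]
    have m1 : Measurable fun q : S × Ω => θ i * k i q.1 :=
      ((hk i).comp measurable_fst).const_mul _
    have m2 : Measurable fun q : S × Ω => ∑ i ∈ s, θ i * k i q.1 :=
      Finset.measurable_fun_sum s fun j _ => ((hk j).comp measurable_fst).const_mul _
    exact ((hY i).const_mul (θ i)).add hW m1.aestronglyMeasurable m2.aestronglyMeasurable ih

theorem map_sum_eq_gaussianReal [SFinite c] (hτ : Measurable τ) (hW : IsGaussianBasis P c W)
    (hC : IsCompatible P c τ ℱ W) {ι : Type*} (s : Finset ι) {k : ι → S → ℝ}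
    (hk : ∀ i, Measurable (k i)) (hk2 : ∀ i, MemLp (k i) 2 c) (θ : ι → ℝ) {Y : ι → Ω → ℝ}
    (hY : ∀ i, IsStochIntegral P c τ ℱ W (fun z _ => k i z) (Y i)) :
    P.map (fun ω => ∑ i ∈ s, θ i * Y i ω) =
      gaussianReal 0 (variance (fun ω => ∑ i ∈ s, θ i * Y i ω) P).toNNReal := by
  have h := IsStochIntegral.sum_const_mul hW s hk θ hY
  rw [variance_eq_toReal_eLpNorm_sq h.1 (h.integral_eq_zero hW hC)]
  exact h.map_eq_gaussianReal hτ hW hC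
    (Finset.measurable_fun_sum s fun j _ => (hk j).const_mul _)
    (memLp_finsetSum s fun j _ => (hk2 j).const_mul _)

/-- The null set where σ(s) differs from v may depend on s. By Fubini the exceptional pairs are
still c ⊗ P-null, and the integral only sees its integrand up to such sets. -/
theorem IsStochIntegral.of_constant_volatility {d : ℕ} {σ : Space d → Ω → ℝ} {ρ : S → Space d}
    [SFinite c] (hσρ : Measurable fun q : S × Ω => σ (ρ q.1) q.2) {v : ℝ}
    (hv : ∀ s, ∀ᵐ ω ∂P, σ s ω = v) {k : S → ℝ} {Y : Ω → ℝ}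
    (hY : IsStochIntegral P c τ ℱ W (fun z ω => k z * σ (ρ z) ω) Y) :
    IsStochIntegral P c τ ℱ W (fun z _ => v * k z) Y := by
  refine hY.congr_ae ?_
  have : ∀ᵐ q ∂(c.prod P), σ (ρ q.1) q.2 = v :=
    (Measure.ae_prod_iff_ae_ae (measurableSet_eq_fun hσρ measurable_const)).2
      (Eventually.of_forall fun z => hv (ρ z))
  filter_upwards [this] with q hq
  rw [hq, mul_comm]

theorem eLpNorm_stochIntegral_modulated {d : ℕ} [NeZero d] [SFinite c] {σ : Space d → Ω → ℝ}
    (hstat : StrictlyStationary P σ) {ρ : S → Space d}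
    (hσρ : Measurable fun q : S × Ω => σ (ρ q.1) q.2) (hτ : Measurable τ)
    (hW : IsGaussianBasis P c W) (hC : IsCompatible P c τ ℱ W)
    {k : S → ℝ} (hk : Measurable k) {Y : Ω → ℝ}
    (hY : IsStochIntegral P c τ ℱ W (fun z ω => k z * σ (ρ z) ω) Y) :
    eLpNorm Y 2 P = eLpNorm k 2 c * eLpNorm (σ 0) 2 P := by
  rw [hY.eLpNorm_eq hτ hW hC ((hk.comp measurable_fst).mul hσρ).aestronglyMeasurable,
    eLpNorm_modulated hstat hk hσρ]

theorem eLpNorm_stochIntegral_modulated_sub {d : ℕ} [NeZero d] [SFinite c] {σ : Space d → Ω → ℝ}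
    (hstat : StrictlyStationary P σ) {ρ : S → Space d}
    (hσρ : Measurable fun q : S × Ω => σ (ρ q.1) q.2) (hτ : Measurable τ)
    (hW : IsGaussianBasis P c W) (hC : IsCompatible P c τ ℱ W)
    {k k' : S → ℝ} (hk : Measurable k) (hk' : Measurable k') {Y Y' : Ω → ℝ}
    (hY : IsStochIntegral P c τ ℱ W (fun z ω => k z * σ (ρ z) ω) Y)
    (hY' : IsStochIntegral P c τ ℱ W (fun z ω => k' z * σ (ρ z) ω) Y') :
    eLpNorm (fun ω => Y ω - Y' ω) 2 P =
      eLpNorm (fun z => k z - k' z) 2 c * eLpNorm (σ 0) 2 P := by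
  refine eLpNorm_stochIntegral_modulated hstat hσρ hτ hW hC (k := fun z => k z - k' z)
    (hk.sub hk') ?_
  simpa only [sub_mul] using hY.sub hW ((hk.comp measurable_fst).mul hσρ).aestronglyMeasurable
    ((hk'.comp measurable_fst).mul hσρ).aestronglyMeasurable hY'

end ConstantVolatility

end VMMMA

/-! ### The main theorem -/

open VMMMA

theorem mainTheorem11 {d : ℕ} [NeZero d]
    {𝒳 : Type*} [MeasurableSpace 𝒳] (p : Measure 𝒳) [IsProbabilityMeasure p]
    {Ω : Type*} [mΩ : MeasurableSpace Ω] (P : Measure Ω) [IsProbabilityMeasure P]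
    -- the weight function `g`
    (g : 𝒳 → VMMMA.Space d → ℝ) (hg_meas : Measurable (Function.uncurry g))
    (hg : MemLp (Function.uncurry g) 2 (p.prod volume))
    -- the volatility field `σ`
    (σ : VMMMA.Space d → Ω → ℝ) (hσ_stat : VMMMA.StrictlyStationary P σ)
    (hσ_sq : MemLp (σ 0) 2 P)
    -- the noise driving the mixed field `X`
    (W : Set (𝒳 × VMMMA.Space d) → Ω → ℝ) (ℱ : Filtration ℝ mΩ)
    (hW : VMMMA.IsGaussianBasis P (p.prod volume) W)
    (hWℱ : VMMMA.IsCompatible P (p.prod volume) (fun z => VMMMA.time z.2) ℱ W)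
    (hσℱ : Measurable[VMMMA.predictableAlgebra VMMMA.time ℱ] (Function.uncurry σ))
    (hσW : Indep (VMMMA.fieldAlgebra σ) (VMMMA.noiseAlgebra (p.prod volume) W Set.univ) P)
    -- the noise driving the field `Z`
    (B : Set (VMMMA.Space d) → Ω → ℝ) (𝒢 : Filtration ℝ mΩ)
    (hB : VMMMA.IsGaussianBasis P volume B)
    (hB𝒢 : VMMMA.IsCompatible P volume VMMMA.time 𝒢 B)
    (hσ𝒢 : Measurable[VMMMA.predictableAlgebra VMMMA.time 𝒢] (Function.uncurry σ))
    (hσB : Indep (VMMMA.fieldAlgebra σ) (VMMMA.noiseAlgebra volume B Set.univ) P)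
    -- the weight function `f`, proportional to the Fourier transform of `γ^{1/2}`
    (ĝ : 𝒳 → VMMMA.Space d → ℂ) (hĝ : VMMMA.IsPartialFourier p g ĝ)
    (f : VMMMA.Space d → ℝ) (hf_meas : Measurable f) (κ : ℝ) (hκ : κ ≠ 0)
    (hf : ∀ᵐ s : VMMMA.Space d,
      (f s : ℂ) = (κ : ℂ) * VMMMA.l2Fourier (VMMMA.gammaRoot p ĝ) s) :
    -- everything is well defined
    (MemLp (VMMMA.gammaRoot p ĝ) 2 volume ∧
      (∀ᵐ s : VMMMA.Space d, (VMMMA.l2Fourier (VMMMA.gammaRoot p ĝ) s).im = 0) ∧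
      (∀ t, VMMMA.IsStochIntegral P (p.prod volume) (fun z => VMMMA.time z.2) ℱ W
        (VMMMA.mixedIntegrand g σ t) (VMMMA.vmmma P p ℱ W g σ t)) ∧
      (∀ t, VMMMA.IsStochIntegral P volume VMMMA.time 𝒢 B
        (VMMMA.integrand f σ t) (VMMMA.vmma P 𝒢 B f σ t))) ∧
    -- identical correlation structure
    (∀ t t', covariance (VMMMA.vmma P 𝒢 B f σ t) (VMMMA.vmma P 𝒢 B f σ t') P =
        κ ^ 2 * covariance (VMMMA.vmmma P p ℱ W g σ t) (VMMMA.vmmma P p ℱ W g σ t') P) ∧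
    (∀ t t', VMMMA.correlation P (VMMMA.vmma P 𝒢 B f σ t) (VMMMA.vmma P 𝒢 B f σ t') =
        VMMMA.correlation P (VMMMA.vmmma P p ℱ W g σ t) (VMMMA.vmmma P p ℱ W g σ t')) ∧
    -- without stochastic volatility: identical finite dimensional distributions
    ((∃ v : ℝ, ∀ s, ∀ᵐ ω ∂P, σ s ω = v) →
      VMMMA.SameFDD P (VMMMA.vmma P 𝒢 B f σ)
          (fun t ω => |κ| * VMMMA.vmmma P p ℱ W g σ t ω) ∧
      (|κ| = 1 → VMMMA.SameFDD P (VMMMA.vmma P 𝒢 B f σ) (VMMMA.vmmma P p ℱ W g σ))) := by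
  
  have hρ : Measurable (Prod.snd : 𝒳 × Space d → Space d) := measurable_snd
  have hτX : Measurable fun z : 𝒳 × Space d => time z.2 := measurable_time.comp hρ
  have hσX : Measurable fun q : (𝒳 × Space d) × Ω => σ q.1.2 q.2 :=
    (measurable_field_comp hρ hσℱ).mono (predictableAlgebra_le hτX) le_rfl
  have hσZ : Measurable fun q : Space d × Ω => σ q.1 q.2 :=
    hσ𝒢.mono (predictableAlgebra_le measurable_time) le_rfl
  have hkX : ∀ t : Space d, Measurable fun z : 𝒳 × Space d => g z.1 (t - z.2) := fun t =>
    hg_meas.comp (measurable_fst.prodMk (measurable_snd.const_sub t))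
  have hkZ : ∀ t : Space d, Measurable fun s => f (t - s) := fun t =>
    hf_meas.comp (measurable_id.const_sub t)
  have hγ := memLp_gammaRoot hg_meas hg hĝ
  have hkX2 : ∀ t : Space d, MemLp (fun z : 𝒳 × Space d => g z.1 (t - z.2)) 2 (p.prod volume) :=
    fun t => hg.comp_measurePreserving (measurePreserving_sub_snd t)
  have hkZ2 : ∀ t : Space d, MemLp (fun s => f (t - s)) 2 volume := fun t =>
    (memLp_of_ae_eq_l2Fourier hγ hf_meas hf).comp_measurePreserving
      (Measure.measurePreserving_sub_left volume t)
  have hX : ∀ t, IsStochIntegral P (p.prod volume) (fun z => time z.2) ℱ W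
      (fun z ω => g z.1 (t - z.2) * σ z.2 ω) (vmmma P p ℱ W g σ t) := fun t =>
    isStochIntegral_stochIntegral (exists_isStochIntegral_modulated hρ hW hWℱ hσ_stat hσ_sq hσℱ
      (hkX t) (hkX2 t))
  have hZ : ∀ t, IsStochIntegral P volume time 𝒢 B
      (fun s ω => f (t - s) * σ s ω) (vmma P 𝒢 B f σ t) := fun t =>
    isStochIntegral_stochIntegral (exists_isStochIntegral_modulated measurable_id hB hB𝒢 hσ_stat
      hσ_sq hσ𝒢 (hkZ t) (hkZ2 t))
  have hcov : ∀ t t', covariance (vmma P 𝒢 B f σ t) (vmma P 𝒢 B f σ t') P =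
      κ ^ 2 * covariance (vmmma P p ℱ W g σ t) (vmmma P p ℱ W g σ t') P := by
    have hn : ∀ t, eLpNorm (vmma P 𝒢 B f σ t) 2 P = ‖κ‖ₑ * eLpNorm (vmmma P p ℱ W g σ t) 2 P :=
      fun t => by
        rw [eLpNorm_stochIntegral_modulated (ρ := id) hσ_stat hσZ measurable_time hB hB𝒢 (hkZ t)
          (hZ t), eLpNorm_stochIntegral_modulated hσ_stat hσX hτX hW hWℱ (hkX t) (hX t),
          eLpNorm_shift hg_meas hg hĝ hf_meas hf, mul_assoc]
    intro t t'
    refine covariance_eq_sq_mul (hX t).1 (hX t').1 (hZ t).1 (hZ t').1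
      ((hX t).integral_eq_zero hW hWℱ) ((hX t').integral_eq_zero hW hWℱ)
      ((hZ t).integral_eq_zero hB hB𝒢) ((hZ t').integral_eq_zero hB hB𝒢) (hn t) (hn t') ?_
    rw [eLpNorm_stochIntegral_modulated_sub (ρ := id) hσ_stat hσZ measurable_time hB hB𝒢 (hkZ t)
      (hkZ t') (hZ t) (hZ t'), eLpNorm_stochIntegral_modulated_sub hσ_stat hσX hτX hW hWℱ (hkX t)
      (hkX t') (hX t) (hX t'), eLpNorm_shift_sub_shift hg_meas hg hĝ hf_meas hf, mul_assoc]
  refine ⟨⟨hγ, l2Fourier_gammaRoot_im hg_meas hg hĝ, hX, hZ⟩, hcov, fun t t' =>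
    correlation_eq_of_covariance hκ (hX t).1 (hX t').1 (hZ t).1 (hZ t').1 (hcov t t') (hcov t t)
      (hcov t' t'), ?_⟩
  rintro ⟨v, hv⟩
  have hXv := fun t => ((hX t).of_constant_volatility hσX hv).const_mul |κ|
  have hZv := fun t => (hZ t).of_constant_volatility (ρ := id) hσZ hv
  have hfdd : SameFDD P (vmma P 𝒢 B f σ) (fun t ω => |κ| * vmmma P p ℱ W g σ t ω) := by
    refine sameFDD_of_gaussian (fun t => (hXv t).1) (fun t => (hZv t).1) (fun n t θ => ?_)
      (fun n t θ => ?_) fun t t' => ?_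
    · exact map_sum_eq_gaussianReal hτX hW hWℱ Finset.univ
        (fun i => ((hkX (t i)).const_mul v).const_mul |κ|)
        (fun i => ((hkX2 (t i)).const_mul v).const_mul |κ|) θ fun i => hXv (t i)
    · exact map_sum_eq_gaussianReal measurable_time hB hB𝒢 Finset.univ
        (fun i => (hkZ (t i)).const_mul v) (fun i => (hkZ2 (t i)).const_mul v) θ fun i => hZv (t i)
    -- Since |κ|·|κ| = κ², the field |κ|X has exactly the covariances of Z; the sign of κ plays no
    -- role.
    · rw [hcov, covariance_const_mul_left, covariance_const_mul_right, ← mul_assoc, abs_mul_abs_self,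
        sq]
  refine ⟨hfdd, fun h1 => ?_⟩
  simpa only [h1, one_mul] using hfdd
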